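/- There are a deterministic algorithm and an absolute constant $C$ such that the following holds. The input of the algorithm is a mixed graph $G=(V,E,A)$ with $n$ vertices, where $E$ is the set of undirected edges and $A$ is the set of arcs, together with a set $\mathcal{T}\subseteq V\times V$ of terminal pairs $(s,t)$ with $s\neq t$. The algorithm decides the Steiner Orientation problem, that is, it decides whether each edge in $E$ can be given exactly one of its two directions so that the resulting directed graph has a directed path from $s$ to $t$ for every $(s,t)\in\mathcal{T}$. It runs in time $n^{O(\mathrm{vc}^2)}$; precisely, it halts after at most $\max\{n,2\}^{\,C\cdot\max\{\mathrm{vc},1\}^2}$ steps of a unit-cost random access machine with addition and subtraction, where $\mathrm{vc}$ is the vertex cover number of the underlying graph of $G$ (the undirected graph obtained by replacing each arc by an edge with the same endpoints). The bound is $n^{C\cdot\mathrm{vc}^2}$ whenever $G$ has at least one edge or arc. -/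

import Mathlib

/-! ### Mixed graphs, orientations and the Steiner Orientation problem -/

/-- A (simple, loopless) mixed graph `G = (V, E, A)`: undirected edges `E` and arcs `A`. An edge and
an arc, or two opposite arcs, may share their endpoints. -/
structure MixedGraph (V : Type*) where
  /-- the undirected edges `E` -/
  edges : SimpleGraph V
  /-- the arcs `A`, where `(u, v)` is directed from `u` to `v` -/
  arcs : Set (V × V)
  /-- there are no loops -/
  arcs_loopless : ∀ v, (v, v) ∉ arcs

namespace MixedGraph

variable {V : Type*}

/-- The underlying graph, obtained by replacing every arc by an edge with the same endpoints. -/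
def underlying (G : MixedGraph V) : SimpleGraph V where
  Adj u v := G.edges.Adj u v ∨ (u, v) ∈ G.arcs ∨ (v, u) ∈ G.arcs
  symm := ⟨fun _ _ h => h.elim (fun h => Or.inl h.symm) (fun h => Or.inr h.symm)⟩
  loopless := ⟨fun v h => h.elim G.edges.irrefl
    (fun h => h.elim (G.arcs_loopless v) (G.arcs_loopless v))⟩

/-- `D` is an orientation of the undirected edges of `G`: it consists of exactly one of the arcs
`(u, v)` and `(v, u)` for every undirected edge `{u, v}`, and of nothing else. -/
def IsOrientation (G : MixedGraph V) (D : Set (V × V)) : Prop :=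
  (∀ u v, G.edges.Adj u v ↔ (u, v) ∈ D ∨ (v, u) ∈ D) ∧
    ∀ u v, (u, v) ∈ D → (v, u) ∉ D

/-- In the directed graph with arc set `B` there is a directed path from `s` to `t`. -/
def HasDirectedPath (B : Set (V × V)) (s t : V) : Prop :=
  Relation.ReflTransGen (fun u v => (u, v) ∈ B) s t

end MixedGraph

/-- An instance of Steiner Orientation with vertex set `{0, …, n - 1}`: a mixed graph together with
a set of terminal pairs `(s, t)`, `s ≠ t`. -/
structure SteinerInstance (n : ℕ) where
  /-- the mixed graph -/
  graph : MixedGraph (Fin n)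
  /-- the terminal pairs -/
  terminals : Set (Fin n × Fin n)
  /-- the two members of a terminal pair are distinct -/
  terminals_ne : ∀ p ∈ terminals, p.1 ≠ p.2

namespace SteinerInstance

variable {n : ℕ}

/-- The instance is a yes-instance: some orientation `D` of the undirected edges makes, together
with the arcs, every demanded directed path exist. -/
def IsYes (I : SteinerInstance n) : Prop :=
  ∃ D : Set (Fin n × Fin n), I.graph.IsOrientation D ∧
    ∀ p ∈ I.terminals, MixedGraph.HasDirectedPath (D ∪ I.graph.arcs) p.1 p.2

/-- The vertex cover number of the underlying graph. -/
noncomputable def vc (I : SteinerInstance n) : ℕ :=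
  I.graph.underlying.vertexCoverNum.toNat

open Classical in
/-- The entries of an `n × n` zero-one matrix, row by row. -/
noncomputable def matrixBits (R : Fin n → Fin n → Prop) : List ℕ :=
  (List.finRange n).flatMap fun u => (List.finRange n).map fun v => if R u v then 1 else 0

/-- The input given to an algorithm: the number of vertices, followed by the adjacency matrices of
the undirected edges, of the arcs, and of the terminal pairs (`1 + 3 n ^ 2` numbers). -/
noncomputable def encode (I : SteinerInstance n) : List ℕ :=
  n :: (matrixBits (fun u v => I.graph.edges.Adj u v) ++
    matrixBits (fun u v => (u, v) ∈ I.graph.arcs) ++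
    matrixBits (fun u v => (u, v) ∈ I.terminals))

end SteinerInstance

/-! ### Random access machines with unit cost -/

namespace RAM

/-- The state of a random access machine: registers, which a program names explicitly (so a program
uses only finitely many of them), and a memory that is addressed indirectly. -/
structure State where
  reg : ℕ → ℕ
  mem : ℕ → ℕ

/-- The elementary instructions: constants, addition, truncated subtraction, and indirect memory
access. There is no multiplication and there are no shifts, so `t` steps only produce numbers whose
bit length exceeds that of the input numbers and program constants by `O(t)`: the unit cost of these
instructions is polynomially equivalent to logarithmic cost and to Turing machine time. -/
inductive Instr where
  /-- `rᵢ := c` -/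
  | const (i c : ℕ)
  /-- `rᵢ := rⱼ + rₖ` -/
  | add (i j k : ℕ)
  /-- `rᵢ := max (rⱼ - rₖ) 0` -/
  | sub (i j k : ℕ)
  /-- `rᵢ := mem[rⱼ]` -/
  | load (i j : ℕ)
  /-- `mem[rᵢ] := rⱼ` -/
  | store (i j : ℕ)

/-- The effect of an elementary instruction. -/
def Instr.apply : Instr → State → State
  | .const i c, s => { s with reg := Function.update s.reg i c }
  | .add i j k, s => { s with reg := Function.update s.reg i (s.reg j + s.reg k) }
  | .sub i j k, s => { s with reg := Function.update s.reg i (s.reg j - s.reg k) }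
  | .load i j, s => { s with reg := Function.update s.reg i (s.mem (s.reg j)) }
  | .store i j, s => { s with mem := Function.update s.mem (s.reg i) (s.reg j) }

/-- Programs, with structured control flow. -/
inductive Program where
  /-- do nothing -/
  | skip
  /-- perform an elementary instruction -/
  | instr (a : Instr)
  /-- first `p`, then `q` -/
  | seq (p q : Program)
  /-- if `rᵢ ≠ 0` then `p` else `q` -/
  | ite (i : ℕ) (p q : Program)
  /-- while `rᵢ ≠ 0` do `p` -/
  | loop (i : ℕ) (p : Program)

/-- `Runs p s s' t`: the program `p`, started in state `s`, halts in state `s'` after exactly `t`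
steps. Each elementary instruction and each test of a register is one step. -/
inductive Runs : Program → State → State → ℕ → Prop where
  | skip (s : State) : Runs .skip s s 1
  | instr (a : Instr) (s : State) : Runs (.instr a) s (a.apply s) 1
  | seq {p q : Program} {s s' s'' : State} {t t' : ℕ} :
      Runs p s s' t → Runs q s' s'' t' → Runs (.seq p q) s s'' (t + t')
  | ite_true {i : ℕ} {p q : Program} {s s' : State} {t : ℕ} :
      s.reg i ≠ 0 → Runs p s s' t → Runs (.ite i p q) s s' (t + 1)
  | ite_false {i : ℕ} {p q : Program} {s s' : State} {t : ℕ} :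
      s.reg i = 0 → Runs q s s' t → Runs (.ite i p q) s s' (t + 1)
  | loop_done {i : ℕ} {p : Program} {s : State} :
      s.reg i = 0 → Runs (.loop i p) s s 1
  | loop_step {i : ℕ} {p : Program} {s s' s'' : State} {t t' : ℕ} :
      s.reg i ≠ 0 → Runs p s s' t → Runs (.loop i p) s' s'' t' →
        Runs (.loop i p) s s'' (t + t' + 1)

/-- Programs are deterministic: the final state and the number of steps are unique. -/
theorem Runs.deterministic {p : Program} {s s₁ s₂ : State} {t₁ t₂ : ℕ}
    (h₁ : Runs p s s₁ t₁) (h₂ : Runs p s s₂ t₂) : s₁ = s₂ ∧ t₁ = t₂ := by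
  induction h₁ generalizing s₂ t₂ with
  | skip s => cases h₂; exact ⟨rfl, rfl⟩
  | instr a s => cases h₂; exact ⟨rfl, rfl⟩
  | seq _ _ ih ih' =>
    cases h₂ with
    | seq a b =>
      obtain ⟨rfl, rfl⟩ := ih a
      obtain ⟨rfl, rfl⟩ := ih' b
      exact ⟨rfl, rfl⟩
  | ite_true h _ ih =>
    cases h₂ with
    | ite_true _ a => obtain ⟨rfl, rfl⟩ := ih a; exact ⟨rfl, rfl⟩
    | ite_false h' _ => exact absurd h' h
  | ite_false h _ ih =>
    cases h₂ with
    | ite_true h' _ => exact absurd h h'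
    | ite_false _ a => obtain ⟨rfl, rfl⟩ := ih a; exact ⟨rfl, rfl⟩
  | loop_done h =>
    cases h₂ with
    | loop_done _ => exact ⟨rfl, rfl⟩
    | loop_step h' _ _ => exact absurd h h'
  | loop_step h _ _ ih ih' =>
    cases h₂ with
    | loop_done h' => exact absurd h' h
    | loop_step _ a b =>
      obtain ⟨rfl, rfl⟩ := ih a
      obtain ⟨rfl, rfl⟩ := ih' b
      exact ⟨rfl, rfl⟩

/-- The initial state on an input list: the input is in the first memory cells, and all registers
and all other memory cells are zero. -/
def initial (input : List ℕ) : State where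
  reg := fun _ => 0
  mem := fun a => input.getD a 0

end RAM

/-!
# Steiner Orientation in time `n ^ O(vc ^ 2)`

*Preprocessing.* If an undirected edge `uv` can be completed to a mixed cycle by a mixed path from
`v` to `u`, it may be oriented from `u` to `v`: turning all edges of the cycle in its direction makes
the vertices of the cycle strongly connected, so no directed path gets lost
(`solvable_orient_iff`). After all edges have been tried, no undirected edge lies on a mixed cycle.

*Certificates.* Let `X` be a vertex cover of size `k`. All vertices outside `X` have their neighbours
in `X`. Fix, as in some solution, the directions of at most `4 k ^ 2` edges: for every pair `(x, y)` in
`X`, the edge from `x` to `y`, the edges of one path from `x` to `y` through a vertex outside `X`, and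
one edge at a vertex outside `X` that is adjacent to both along undirected edges (there is at most
one such vertex, as two of them would lie on a cycle of length four). Then the fixed arcs join the
same pairs in `X` as the solution, and every vertex outside `X` has at most one edge left
(`exists_linked`). Whether a terminal pair gets joined depends only on the directions of the edges
left at its two members. So the rest is an instance of 2-satisfiability with one variable for every
vertex, which is solvable iff no variable is equivalent to its negation
(`exists_forall_iff_transGen`). Conversely, a satisfying assignment yields a solution for any `X` and
any set of fixed arcs (`solvable_of_linked`).

*The algorithm.* It tries, for `k = 0, 1, …`, all `n ^ (k + 8 k ^ 2)` certificates, and stops after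
the first `k` for which some certificate contains a vertex cover. The preprocessing and the test of
a certificate are written in a small language of loops and first-order definitions of relations; its
statements are compiled to the random access machine with polynomial running time
(`Stmt.compile_exec`, `Stmt.cost_polyBounded`). The enumeration is written directly in the
instructions of the machine (`loop_levelProg_exec`).
-/

namespace SteinerOrientation

open Relation RAM

local infixr:60 " ;; " => RAM.Program.seq

/-! ### Orienting the edges of mixed cycles -/

section Mixed

variable {V : Type*}

/-- `D` consists of exactly one direction of every edge of `E`, and of nothing else. -/
def Orients (D E : V → V → Prop) : Prop :=
  (∀ u v, E u v ↔ D u v ∨ D v u) ∧ ∀ u v, D u v → ¬ D v u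

/-- `Joins D A s t`: there is a directed path from `s` to `t` using the arcs of `D` and of `A`. -/
def Joins (D A : V → V → Prop) : V → V → Prop :=
  ReflTransGen fun u v => D u v ∨ A u v

/-- Steiner Orientation, with edges, arcs and terminal pairs given as relations. -/
def Solvable (E A T : V → V → Prop) : Prop :=
  ∃ D, Orients D E ∧ ∀ s t, T s t → Joins D A s t

/-- The relation `E` without the two pairs `(u, v)` and `(v, u)`. -/
def deleteEdge (E : V → V → Prop) (u v : V) : V → V → Prop :=
  fun a b => E a b ∧ ¬ ((a = u ∧ b = v) ∨ (a = v ∧ b = u))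

/-- The relation `A` together with the pair `(u, v)`. -/
def insertArc (A : V → V → Prop) (u v : V) : V → V → Prop :=
  fun a b => A a b ∨ (a = u ∧ b = v)

/-- The edge `uv` can be completed, in the direction from `u` to `v`, to a mixed closed walk. -/
def OnMixedCycle (E A : V → V → Prop) (u v : V) : Prop :=
  E u v ∧ Joins (deleteEdge E u v) A v u

variable {E A T D D' A' : V → V → Prop} {u v : V}

theorem Joins.mono (hD : ∀ a b, D a b → D' a b) (hA : ∀ a b, A a b → A' a b) {s t : V}
    (h : Joins D A s t) : Joins D' A' s t :=
  ReflTransGen.mono (fun a b => Or.imp (hD a b) (hA a b)) _ _ h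

theorem Joins.trans {s t w : V} (h : Joins D A s t) (h' : Joins D A t w) : Joins D A s w :=
  ReflTransGen.trans h h'

/-- A mixed walk can be made consistent: it needs only one direction of every edge. The tails of the
chosen directions are kept reachable, so that an edge met for the second time, in the opposite
direction, need not be traversed. -/
theorem exists_consistent_walk {H : V → V → Prop} (hirr : ∀ a, ¬ H a a) {s t : V}
    (h : Joins H A s t) :
    ∃ Q : V → V → Prop, (∀ a b, Q a b → H a b) ∧ (∀ a b, Q a b → ¬ Q b a) ∧
      Joins Q A s t ∧ ∀ a b, Q a b → Joins Q A s a := by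
  induction h with
  | refl => exact ⟨fun _ _ => False, by simp, by simp, .refl, by simp⟩
  | @tail w z _ hwz ih =>
    obtain ⟨Q, hQH, hQ, hw, hreach⟩ := ih
    rcases hwz with hwz | hwz
    · by_cases h1 : Q z w
      · exact ⟨Q, hQH, hQ, hreach _ _ h1, hreach⟩
      · have mono : ∀ {c}, Joins Q A s c → Joins (insertArc Q w z) A s c :=
          fun h => h.mono (fun _ _ => Or.inl) fun _ _ => id
        refine ⟨insertArc Q w z, ?_, ?_, (mono hw).tail (Or.inl (Or.inr ⟨rfl, rfl⟩)), ?_⟩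
        · rintro a b (h | ⟨rfl, rfl⟩)
          exacts [hQH _ _ h, hwz]
        · rintro a b (h | ⟨rfl, rfl⟩) (h' | ⟨h', h''⟩)
          · exact hQ _ _ h h'
          · subst h' h''
            exact h1 h
          · exact h1 h'
          · subst h'
            exact hirr _ hwz
        · rintro a b (h | ⟨rfl, rfl⟩)
          exacts [mono (hreach _ _ h), mono hw]
    · exact ⟨Q, hQH, hQ, hw.tail (Or.inr hwz), hreach⟩

/-- A consistent mixed walk all of whose chosen edges lie on a walk from `s` to `t`. -/
theorem exists_trimmed_walk {H : V → V → Prop} (hirr : ∀ a, ¬ H a a) {s t : V}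
    (h : Joins H A s t) :
    ∃ Q : V → V → Prop, (∀ a b, Q a b → H a b) ∧ (∀ a b, Q a b → ¬ Q b a) ∧
      Joins Q A s t ∧ ∀ a b, Q a b → Joins Q A s a ∧ Joins Q A b t := by
  obtain ⟨Q, hQH, hQ, hst, hreach⟩ := exists_consistent_walk hirr h
  have trim : ∀ {a c}, Joins Q A a c → Joins Q A c t →
      Joins (fun a b => Q a b ∧ Joins Q A b t) A a c := by
    intro a c hac hct
    induction hac using ReflTransGen.head_induction_on with
    | refl => exact .refl
    | head hab hbc ih =>
      exact ih.head (hab.imp (fun h => ⟨h, hbc.trans hct⟩) id)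
  refine ⟨fun a b => Q a b ∧ Joins Q A b t, fun a b h => hQH _ _ h.1,
    fun a b h h' => hQ _ _ h.1 h'.1, trim hst .refl, fun a b h => ⟨?_, trim h.2 .refl⟩⟩
  exact trim (hreach _ _ h.1) (h.2.head (Or.inl h.1))

/-- Orienting an edge along a mixed cycle through it is safe: turning the whole cycle makes its
vertices strongly connected, so that no directed path is lost. -/
theorem solvable_orient_iff (hsymm : ∀ a b, E a b → E b a) (hirr : ∀ a, ¬ E a a)
    (h : OnMixedCycle E A u v) :
    Solvable (deleteEdge E u v) (insertArc A u v) T ↔ Solvable E A T := by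
  obtain ⟨huv, hcyc⟩ := h
  have hne : u ≠ v := by
    rintro rfl
    exact hirr _ huv
  constructor
  · rintro ⟨D, ⟨hDE, hD⟩, hT⟩
    have hno : ¬ D u v ∧ ¬ D v u := by
      constructor <;> intro h'
      · exact ((hDE u v).2 (Or.inl h')).2 (Or.inl ⟨rfl, rfl⟩)
      · exact ((hDE u v).2 (Or.inr h')).2 (Or.inl ⟨rfl, rfl⟩)
    refine ⟨insertArc D u v, ⟨fun a b => ⟨fun hab => ?_, ?_⟩, ?_⟩, fun s t hst => ?_⟩
    · by_cases h1 : (a = u ∧ b = v) ∨ (a = v ∧ b = u)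
      · rcases h1 with h1 | h1
        · exact Or.inl (Or.inr h1)
        · exact Or.inr (Or.inr h1.symm)
      · exact ((hDE a b).1 ⟨hab, h1⟩).imp Or.inl Or.inl
    · rintro ((h1 | ⟨rfl, rfl⟩) | (h1 | ⟨rfl, rfl⟩))
      · exact ((hDE a b).2 (Or.inl h1)).1
      · exact huv
      · exact ((hDE a b).2 (Or.inr h1)).1
      · exact hsymm _ _ huv
    · rintro a b (h1 | ⟨rfl, rfl⟩) (h2 | ⟨h2, h3⟩)
      · exact hD _ _ h1 h2
      · subst h2 h3
        exact hno.2 h1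
      · exact hno.2 h2
      · exact hne h3
    · refine ReflTransGen.mono ?_ _ _ (hT s t hst)
      rintro a b (h1 | h1 | h1)
      exacts [Or.inl (Or.inl h1), Or.inr h1, Or.inl (Or.inr h1)]
  · rintro ⟨D, ⟨hDE, hD⟩, hT⟩
    have hsymm' : ∀ a b, deleteEdge E u v a b → deleteEdge E u v b a := fun a b h =>
      ⟨hsymm _ _ h.1, fun h' => h.2 (h'.elim (fun h => Or.inr h.symm) fun h => Or.inl h.symm)⟩
    obtain ⟨Q, hQE, hQ, hvu, hreach⟩ := exists_trimmed_walk (fun a h => hirr a h.1) hcyc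
    let D' : V → V → Prop := fun a b => deleteEdge E u v a b ∧ (Q a b ∨ (¬ Q b a ∧ D a b))
    have hQD : ∀ {a b}, Joins Q A a b → Joins D' (insertArc A u v) a b := fun h =>
      h.mono (fun a b h => ⟨hQE _ _ h, Or.inl h⟩) fun a b => Or.inl
    refine ⟨D', ⟨fun a b => ⟨fun hab => ?_, ?_⟩, ?_⟩, fun s t hst => ?_⟩
    · by_cases h1 : Q a b
      · exact Or.inl ⟨hab, Or.inl h1⟩
      by_cases h2 : Q b a
      · exact Or.inr ⟨hsymm' _ _ hab, Or.inl h2⟩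
      exact ((hDE a b).1 hab.1).imp (fun h => ⟨hab, Or.inr ⟨h2, h⟩⟩)
        fun h => ⟨hsymm' _ _ hab, Or.inr ⟨h1, h⟩⟩
    · rintro (h1 | h1)
      exacts [h1.1, hsymm' _ _ h1.1]
    · rintro a b ⟨-, h1 | h1⟩ ⟨-, h2 | h2⟩
      · exact hQ _ _ h1 h2
      · exact h2.1 h1
      · exact h1.1 h2
      · exact hD _ _ h1.2 h2.2
    · have hW : ∀ a b, D a b ∨ A a b → Joins D' (insertArc A u v) a b := by
        rintro a b (hab | hab)
        · by_cases h1 : (a = u ∧ b = v) ∨ (a = v ∧ b = u)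
          · rcases h1 with ⟨rfl, rfl⟩ | ⟨rfl, rfl⟩
            · exact .single (Or.inr (Or.inr ⟨rfl, rfl⟩))
            · exact hQD hvu
          · have hE : deleteEdge E u v a b := ⟨(hDE a b).2 (Or.inl hab), h1⟩
            by_cases h2 : Q b a
            · -- The path leads from `a` along the cycle to `u`, on to `v`, and then to `b`.
              obtain ⟨h3, h4⟩ := hreach _ _ h2
              exact (hQD h4).trans ((hQD h3).head (Or.inr (Or.inr ⟨rfl, rfl⟩)))
            · exact .single (Or.inl ⟨hE, Or.inr ⟨h2, hab⟩⟩)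
        · exact .single (Or.inr (Or.inl hab))
      have h := hT s t hst
      clear hst
      induction h with
      | refl => exact .refl
      | tail _ h ih => exact ih.trans (hW _ _ h)

/-- One step of the preprocessing: orient the edge `uv` if it lies on a mixed cycle. -/
def orientEdges (E A : V → V → Prop) (u v : V) : V → V → Prop :=
  fun a b => E a b ∧ ¬ (((a = u ∧ b = v) ∨ (a = v ∧ b = u)) ∧ OnMixedCycle E A u v)

/-- The arcs after one step of the preprocessing. -/
def orientArcs (E A : V → V → Prop) (u v : V) : V → V → Prop :=
  fun a b => A a b ∨ ((a = u ∧ b = v) ∧ OnMixedCycle E A u v)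

/-- What all steps of the preprocessing preserve, relative to the original instance `E₀`, `A₀`. -/
structure Reduced (E₀ A₀ T E A : V → V → Prop) : Prop where
  symm : ∀ a b, E a b → E b a
  irrefl : ∀ a, ¬ E a a
  solvable_iff : Solvable E A T ↔ Solvable E₀ A₀ T
  adj_iff : ∀ a b, (E a b ∨ A a b ∨ A b a) ↔ (E₀ a b ∨ A₀ a b ∨ A₀ b a)

variable {E₀ A₀ : V → V → Prop}

theorem Reduced.step (h : Reduced E₀ A₀ T E A) (u v : V) :
    Reduced E₀ A₀ T (orientEdges E A u v) (orientArcs E A u v) := by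
  by_cases hc : OnMixedCycle E A u v
  · have hE : orientEdges E A u v = deleteEdge E u v := by
      ext a b; simp [orientEdges, deleteEdge, hc]
    have hA : orientArcs E A u v = insertArc A u v := by
      ext a b; simp [orientArcs, insertArc, hc]
    rw [hE, hA]
    refine ⟨?_, fun a ha => h.irrefl a ha.1,
      (solvable_orient_iff h.symm h.irrefl hc).trans h.solvable_iff, fun a b => ?_⟩
    · rintro a b ⟨hab, hn⟩
      exact ⟨h.symm _ _ hab, fun h' => hn (by tauto)⟩
    · rw [← h.adj_iff]
      have h1 := hc.1
      have h2 := h.symm _ _ hc.1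
      constructor
      · rintro (h3 | (h3 | ⟨rfl, rfl⟩) | (h3 | ⟨rfl, rfl⟩))
        exacts [Or.inl h3.1, Or.inr (Or.inl h3), Or.inl h1, Or.inr (Or.inr h3), Or.inl h2]
      · rintro (h3 | h3 | h3)
        · by_cases h4 : (a = u ∧ b = v) ∨ (a = v ∧ b = u)
          · rcases h4 with h4 | h4
            exacts [Or.inr (Or.inl (Or.inr h4)), Or.inr (Or.inr (Or.inr h4.symm))]
          · exact Or.inl ⟨h3, h4⟩
        · exact Or.inr (Or.inl (Or.inl h3))
        · exact Or.inr (Or.inr (Or.inl h3))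
  · have hE : orientEdges E A u v = E := by
      ext a b; simp [orientEdges, hc]
    have hA : orientArcs E A u v = A := by
      ext a b; simp [orientArcs, hc]
    rwa [hE, hA]

/-- Orienting edges creates no new mixed cycles. -/
theorem not_onMixedCycle_step {a b : V} (h : ¬ OnMixedCycle E A a b)
    (u v : V) : ¬ OnMixedCycle (orientEdges E A u v) (orientArcs E A u v) a b := by
  rintro ⟨h1, h2⟩
  refine h ⟨h1.1, ReflTransGen.mono ?_ _ _ h2⟩
  rintro c d (h3 | h3 | ⟨⟨rfl, rfl⟩, h3⟩)
  · exact Or.inl ⟨h3.1.1, h3.2⟩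
  · exact Or.inr h3
  · refine Or.inl ⟨h3.1, fun h4 => h1.2 ⟨?_, h3⟩⟩
    tauto

theorem not_onMixedCycle_self_step (u v : V) :
    ¬ OnMixedCycle (orientEdges E A u v) (orientArcs E A u v) u v := by
  by_cases h : OnMixedCycle E A u v
  · rintro ⟨h1, -⟩
    exact h1.2 ⟨Or.inl ⟨rfl, rfl⟩, h⟩
  · exact not_onMixedCycle_step h u v

/-! ### Certificates -/

/-- The arcs fixed by a certificate `L`: the pairs of `L` that are edges and whose reversals do not
belong to `L`. -/
def fixedArcs (E L : V → V → Prop) : V → V → Prop :=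
  fun u v => E u v ∧ L u v ∧ ¬ L v u

/-- The edges that the certificate leaves open, from a vertex outside the cover `X` to a vertex
inside. -/
def freeEdge (E L : V → V → Prop) (X : V → Prop) : V → V → Prop :=
  fun u v => ¬ X u ∧ X v ∧ E u v ∧ ¬ fixedArcs E L u v ∧ ¬ fixedArcs E L v u

/-- The pair `(s, t)` gets joined if the free edges of `s` all leave `s` (for `b = true`) or all
enter `s` (for `b = false`), likewise for `t` and `c`, and no other free edge is used. -/
def Linked (E A L : V → V → Prop) (X : V → Prop) (s t : V) (b c : Bool) : Prop :=
  ∃ x y, (x = s ∨ (b = true ∧ freeEdge E L X s x)) ∧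
    (y = t ∨ (c = false ∧ freeEdge E L X t y)) ∧ Joins (fixedArcs E L) A x y

/-- The soundness of certificates: a satisfying assignment tells how to direct the free edges. Nothing
is assumed about `X` and `L`. -/
theorem solvable_of_linked [LinearOrder V] {L : V → V → Prop} {X : V → Prop}
    (hsymm : ∀ a b, E a b → E b a) (hirr : ∀ a, ¬ E a a) (β : V → Bool)
    (h : ∀ s t, T s t → Linked E A L X s t (β s) (β t)) : Solvable E A T := by
  -- Edges that are neither fixed nor free do not matter, and are directed upwards.
  let D : V → V → Prop := fun u v => E u v ∧ ¬ fixedArcs E L v u ∧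
    (fixedArcs E L u v ∨ (freeEdge E L X u v ∧ β u = true) ∨ (freeEdge E L X v u ∧ β v = false) ∨
      (¬ freeEdge E L X u v ∧ ¬ freeEdge E L X v u ∧ u < v))
  have hno : ∀ {u v}, fixedArcs E L u v → ¬ fixedArcs E L v u := fun h h' => h.2.2 h'.2.1
  have hno' : ∀ {u v}, freeEdge E L X u v → ¬ freeEdge E L X v u := fun h h' => h.1 h'.2.1
  refine ⟨D, ⟨fun u v => ⟨fun huv => ?_, ?_⟩, ?_⟩, fun s t hst => ?_⟩
  · have huv' := hsymm _ _ huv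
    have hne : u ≠ v := by
      rintro rfl
      exact hirr _ huv
    by_cases h1 : fixedArcs E L u v
    · exact Or.inl ⟨huv, hno h1, Or.inl h1⟩
    by_cases h2 : fixedArcs E L v u
    · exact Or.inr ⟨huv', h1, Or.inl h2⟩
    by_cases h3 : freeEdge E L X u v
    · cases hβ : β u
      · exact Or.inr ⟨huv', h1, Or.inr (Or.inr (Or.inl ⟨h3, hβ⟩))⟩
      · exact Or.inl ⟨huv, h2, Or.inr (Or.inl ⟨h3, hβ⟩)⟩
    by_cases h4 : freeEdge E L X v u
    · cases hβ : β v
      · exact Or.inl ⟨huv, h2, Or.inr (Or.inr (Or.inl ⟨h4, hβ⟩))⟩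
      · exact Or.inr ⟨huv', h1, Or.inr (Or.inl ⟨h4, hβ⟩)⟩
    rcases lt_or_gt_of_ne hne with h5 | h5
    · exact Or.inl ⟨huv, h2, Or.inr (Or.inr (Or.inr ⟨h3, h4, h5⟩))⟩
    · exact Or.inr ⟨huv', h1, Or.inr (Or.inr (Or.inr ⟨h4, h3, h5⟩))⟩
  · rintro (h1 | h1)
    exacts [h1.1, hsymm _ _ h1.1]
  · rintro u v ⟨-, h1, h2⟩ ⟨-, h3, h4⟩
    rcases h2 with h2 | h2 | h2 | h2
    · exact h3 h2
    all_goals rcases h4 with h4 | h4 | h4 | h4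
    all_goals first
      | exact h1 h4
      | exact hno' h2.1 h4.1
      | exact h4.1 h2.1
      | exact h4.2.1 h2.1
      | exact h2.1 h4.1
      | exact h2.2.1 h4.1
      | exact lt_asymm h2.2.2 h4.2.2
      | exact absurd (h2.2.symm.trans h4.2) (by simp)
  · obtain ⟨x, y, hx, hy, hxy⟩ := h s t hst
    have hfree : ∀ {a b}, freeEdge E L X a b → E a b ∧ ¬ fixedArcs E L a b ∧ ¬ fixedArcs E L b a :=
      fun h => h.2.2
    have h1 : Joins D A s x := by
      rcases hx with rfl | ⟨hb, hx⟩
      · exact .refl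
      · exact .single (Or.inl ⟨(hfree hx).1, (hfree hx).2.2, Or.inr (Or.inl ⟨hx, hb⟩)⟩)
    have h2 : Joins D A y t := by
      rcases hy with rfl | ⟨hb, hy⟩
      · exact .refl
      · exact .single (Or.inl ⟨hsymm _ _ (hfree hy).1, (hfree hy).2.1,
          Or.inr (Or.inr (Or.inl ⟨hy, hb⟩))⟩)
    exact h1.trans (Joins.trans (hxy.mono (fun a b h => ⟨h.1, hno h, Or.inl h⟩) fun _ _ => id) h2)

/-- If no edge lies on a mixed cycle, then at most one vertex outside the cover is adjacent along
undirected edges to two given vertices of the cover. -/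
theorem eq_of_common_neighbors {X : V → Prop} (hsymm : ∀ a b, E a b → E b a)
    (hcyc : ∀ a b, ¬ OnMixedCycle E A a b) {v w x y : V} (hv : ¬ X v) (hw : ¬ X w) (hx : X x)
    (hy : X y) (hxy : x ≠ y) (hvx : E v x) (hvy : E v y) (hwx : E w x) (hwy : E w y) : v = w := by
  by_contra hvw
  have hvX : ∀ {z}, X z → z ≠ v := fun hz h => hv (h ▸ hz)
  have hwX : ∀ {z}, X z → z ≠ w := fun hz h => hw (h ▸ hz)
  refine hcyc v x ⟨hvx, ?_⟩
  have h1 : deleteEdge E v x x w := ⟨hsymm _ _ hwx, by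
    rintro (h | h)
    exacts [hvX hx h.1, hvw h.2.symm]⟩
  have h2 : deleteEdge E v x w y := ⟨hwy, by
    rintro (h | h)
    exacts [hvw h.1.symm, hvX hy h.2]⟩
  have h3 : deleteEdge E v x y v := ⟨hsymm _ _ hvy, by
    rintro (h | h)
    exacts [hvX hy h.1, hxy h.1.symm]⟩
  exact .head (Or.inl h1) (.head (Or.inl h2) (.single (Or.inl h3)))

/-- For every ordered pair of cover vertices, four pairs of vertices suffice to keep one way of
passing from the first to the second, directly or through a vertex outside, and to fix an edge at
the only vertex that is adjacent to both. -/
theorem exists_certificate_pairs {X : V → Prop} (hD : Orients D E)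
    (hsymm : ∀ a b, E a b → E b a) (hcyc : ∀ a b, ¬ OnMixedCycle E A a b) (x y : V) (hx : X x)
    (hy : X y) :
    ∃ g : Fin 4 → V × V, (∀ c, D (g c).1 (g c).2 ∨ (g c).1 = (g c).2) ∧
      (D x y → ∃ c, g c = (x, y)) ∧
      (∀ v, (D x v ∨ A x v) → (D v y ∨ A v y) →
        ∃ w, ((∃ c, g c = (x, w)) ∨ A x w) ∧ ((∃ c, g c = (w, y)) ∨ A w y)) ∧
      (∀ v, ¬ X v → x ≠ y → E v x → E v y → ∃ c, D (g c).1 (g c).2 ∧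
        (g c = (v, x) ∨ g c = (x, v))) := by
  classical
  obtain ⟨p₀, h₀, h₀'⟩ : ∃ p : V × V, (D p.1 p.2 ∨ p.1 = p.2) ∧ (D x y → p = (x, y)) := by
    by_cases h : D x y
    · exact ⟨(x, y), Or.inl h, fun _ => rfl⟩
    · exact ⟨(x, x), Or.inr rfl, fun h' => absurd h' h⟩
  obtain ⟨p₁, p₂, h₁, h₂, h₁₂⟩ : ∃ p q : V × V, (D p.1 p.2 ∨ p.1 = p.2) ∧ (D q.1 q.2 ∨ q.1 = q.2) ∧
      ∀ v, (D x v ∨ A x v) → (D v y ∨ A v y) →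
        ∃ w, (p = (x, w) ∨ A x w) ∧ (q = (w, y) ∨ A w y) := by
    by_cases h : ∃ v, (D x v ∨ A x v) ∧ (D v y ∨ A v y)
    · obtain ⟨w, hw, hw'⟩ := h
      have aux : ∀ a b, D a b ∨ A a b → ∃ p : V × V, (D p.1 p.2 ∨ p.1 = p.2) ∧
          (p = (a, b) ∨ A a b) := by
        rintro a b (h | h)
        · exact ⟨(a, b), Or.inl h, Or.inl rfl⟩
        · exact ⟨(a, a), Or.inr rfl, Or.inr h⟩
      obtain ⟨p, hp, hp'⟩ := aux _ _ hw
      obtain ⟨q, hq, hq'⟩ := aux _ _ hw'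
      exact ⟨p, q, hp, hq, fun _ _ _ => ⟨w, hp', hq'⟩⟩
    · exact ⟨(x, x), (x, x), Or.inr rfl, Or.inr rfl, fun v hv hv' => absurd ⟨v, hv, hv'⟩ h⟩
  obtain ⟨p₃, h₃, h₃'⟩ : ∃ p : V × V, (D p.1 p.2 ∨ p.1 = p.2) ∧
      ∀ v, ¬ X v → x ≠ y → E v x → E v y → D p.1 p.2 ∧ (p = (v, x) ∨ p = (x, v)) := by
    by_cases h : ∃ v, ¬ X v ∧ x ≠ y ∧ E v x ∧ E v y
    · obtain ⟨w, hw, hxy, hwx, hwy⟩ := h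
      have key : ∀ v, ¬ X v → x ≠ y → E v x → E v y → v = w := fun v hv _ hvx hvy =>
        eq_of_common_neighbors hsymm hcyc hv hw hx hy hxy hvx hvy hwx hwy
      rcases (hD.1 w x).1 hwx with h | h
      · refine ⟨(w, x), Or.inl h, fun v hv hxy hvx hvy => ?_⟩
        obtain rfl := key v hv hxy hvx hvy
        exact ⟨h, Or.inl rfl⟩
      · refine ⟨(x, w), Or.inl h, fun v hv hxy hvx hvy => ?_⟩
        obtain rfl := key v hv hxy hvx hvy
        exact ⟨h, Or.inr rfl⟩
    · exact ⟨(x, x), Or.inr rfl, fun v hv hxy hvx hvy => absurd ⟨v, hv, hxy, hvx, hvy⟩ h⟩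
  refine ⟨![p₀, p₁, p₂, p₃], ?_, fun h => ⟨0, h₀' h⟩, fun v hv hv' => ?_,
    fun v hv hxy hvx hvy => ⟨3, h₃' v hv hxy hvx hvy⟩⟩
  · intro c
    fin_cases c
    exacts [h₀, h₁, h₂, h₃]
  · obtain ⟨w, hw, hw'⟩ := h₁₂ v hv hv'
    exact ⟨w, hw.imp_left fun h => ⟨1, h⟩, hw'.imp_left fun h => ⟨2, h⟩⟩

/-- The completeness of certificates: from a solution and a cover of size `k` one obtains a set of
`4 k ^ 2` pairs for which the free edges can be directed vertex by vertex. -/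
theorem exists_linked {k : ℕ} (x : Fin k → V) (hsymm : ∀ a b, E a b → E b a)
    (hcyc : ∀ a b, ¬ OnMixedCycle E A a b)
    (hcov : ∀ a b, E a b ∨ A a b → (∃ i, x i = a) ∨ ∃ i, x i = b)
    (hT : ∀ s, ¬ T s s) (h : Solvable E A T) :
    ∃ (g : Fin (4 * k ^ 2) → V × V) (β : V → Bool), ∀ s t, T s t →
      Linked E A (fun u v => ∃ i, g i = (u, v)) (fun v => ∃ i, x i = v) s t (β s) (β t) := by
  classical
  obtain ⟨D, hD, hjoin⟩ := h
  set X : V → Prop := fun v => ∃ i, x i = v with hX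
  choose g hgD hgdir hgthr hgtwo using fun i j =>
    exists_certificate_pairs (A := A) (X := X) hD hsymm hcyc (x i) (x j) ⟨i, rfl⟩ ⟨j, rfl⟩
  let e : Fin (4 * k ^ 2) ≃ Fin k × Fin k × Fin 4 :=
    (Fintype.equivFinOfCardEq (by simp; ring)).symm
  set g' : Fin (4 * k ^ 2) → V × V := fun i => g (e i).1 (e i).2.1 (e i).2.2 with hg'
  set L : V → V → Prop := fun u v => ∃ i, g' i = (u, v) with hL
  have hLg : ∀ i j c u v, g i j c = (u, v) → L u v := fun i j c u v h =>
    ⟨e.symm (i, j, c), by simpa [hg'] using h⟩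
  have hLD : ∀ u v, L u v → D u v ∨ u = v := by
    rintro u v ⟨i, hi⟩
    have := hgD (e i).1 (e i).2.1 (e i).2.2
    have h' : g (e i).1 (e i).2.1 (e i).2.2 = (u, v) := hi
    rwa [h'] at this
  have hFD : ∀ u v, fixedArcs E L u v → D u v := by
    rintro u v ⟨h1, h2, h3⟩
    refine (hLD u v h2).resolve_right ?_
    rintro rfl
    exact h3 h2
  have hDF : ∀ u v, D u v → L u v → fixedArcs E L u v := by
    intro u v h1 h2
    refine ⟨(hD.1 u v).2 (Or.inl h1), h2, fun h3 => ?_⟩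
    rcases hLD _ _ h3 with h4 | rfl
    · exact hD.2 _ _ h1 h4
    · exact hD.2 _ _ h1 h1
  -- A fixed loop, the filler of the list of pairs, is as good as no arc.
  have hLJ : ∀ u v, L u v → Joins (fixedArcs E L) A u v := by
    intro u v h
    rcases hLD _ _ h with h' | rfl
    · exact .single (Or.inl (hDF _ _ h' h))
    · exact .refl
  have hDE : ∀ u v, D u v ∨ A u v → X u ∨ X v := fun u v h =>
    hcov u v (h.imp_left fun h => (hD.1 u v).2 (Or.inl h))
  -- The fixed arcs join all pairs of cover vertices that the solution joins.
  have hreach : ∀ a, X a → ∀ w, Joins D A a w →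
      (X w → Joins (fixedArcs E L) A a w) ∧
      (¬ X w → ∃ z, X z ∧ Joins (fixedArcs E L) A a z ∧ (D z w ∨ A z w)) := by
    intro a ha w hw
    induction hw with
    | refl => exact ⟨fun _ => .refl, fun h => absurd ha h⟩
    | @tail w z _ hwz ih =>
      by_cases hXw : X w
      · refine ⟨fun hXz => (ih.1 hXw).trans ?_, fun _ => ⟨w, hXw, ih.1 hXw, hwz⟩⟩
        rcases hwz with hwz | hwz
        · obtain ⟨i, rfl⟩ := hXw
          obtain ⟨j, rfl⟩ := hXz
          obtain ⟨c, hc⟩ := hgdir i j hwz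
          exact hLJ _ _ (hLg _ _ _ _ _ hc)
        · exact .single (Or.inr hwz)
      · have hXz : X z := (hDE _ _ hwz).resolve_left hXw
        refine ⟨fun _ => ?_, fun h => absurd hXz h⟩
        obtain ⟨y, ⟨i, rfl⟩, hay, hyw⟩ := ih.2 hXw
        obtain ⟨j, rfl⟩ := hXz
        obtain ⟨w', h1, h2⟩ := hgthr i j w hyw hwz
        refine hay.trans (Joins.trans (t := w') ?_ ?_)
        · rcases h1 with ⟨c, hc⟩ | h1
          exacts [hLJ _ _ (hLg _ _ _ _ _ hc), .single (Or.inr h1)]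
        · rcases h2 with ⟨c, hc⟩ | h2
          exacts [hLJ _ _ (hLg _ _ _ _ _ hc), .single (Or.inr h2)]
  -- A vertex outside the cover has at most one free edge.
  have huniq : ∀ v a b, freeEdge E L X v a → freeEdge E L X v b → a = b := by
    rintro v a b ⟨hv, ⟨i, rfl⟩, h1, h2, h3⟩ ⟨-, ⟨j, rfl⟩, h4, -, -⟩
    by_contra hne
    obtain ⟨c, hc, hc'⟩ := hgtwo i j v hv hne h1 h4
    rcases hc' with hc' | hc'
    · rw [hc'] at hc
      exact h2 (hDF _ _ hc (hLg _ _ _ _ _ hc'))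
    · rw [hc'] at hc
      exact h3 (hDF _ _ hc (hLg _ _ _ _ _ hc'))
  refine ⟨g', fun v => decide (∃ a, freeEdge E L X v a ∧ D v a), fun s t hst => ?_⟩
  have hne : s ≠ t := by
    rintro rfl
    exact hT _ hst
  obtain ⟨a, hXa, hsa, hat⟩ : ∃ a, (¬ X s → X a) ∧ (a = s ∨ ¬ X s ∧ (D s a ∨ A s a)) ∧
      Joins D A a t := by
    by_cases hs : X s
    · exact ⟨s, fun h => absurd hs h, Or.inl rfl, hjoin _ _ hst⟩
    · rcases (hjoin _ _ hst).cases_head with h | ⟨a, h1, h2⟩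
      · exact absurd h hne
      · exact ⟨a, fun _ => (hDE _ _ h1).resolve_left hs, Or.inr ⟨hs, h1⟩, h2⟩
  have hXa : X a := by
    by_cases hs : X s
    · rcases hsa with rfl | h
      exacts [hs, absurd hs h.1]
    · exact hXa hs
  obtain ⟨b, hab, hbt⟩ : ∃ b, Joins (fixedArcs E L) A a b ∧
      (b = t ∨ ¬ X t ∧ X b ∧ (D b t ∨ A b t)) := by
    by_cases ht : X t
    · exact ⟨t, (hreach a hXa t hat).1 ht, Or.inl rfl⟩
    · obtain ⟨b, h1, h2, h3⟩ := (hreach a hXa t hat).2 ht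
      exact ⟨b, h2, Or.inr ⟨ht, h1, h3⟩⟩
  obtain ⟨p, hp, hpa⟩ : ∃ p, (p = s ∨ (decide (∃ a, freeEdge E L X s a ∧ D s a) = true ∧
      freeEdge E L X s p)) ∧ Joins (fixedArcs E L) A p a := by
    rcases hsa with rfl | ⟨hs, h1 | h1⟩
    · exact ⟨a, Or.inl rfl, .refl⟩
    · by_cases hF : fixedArcs E L s a
      · exact ⟨s, Or.inl rfl, .single (Or.inl hF)⟩
      · have hfree : freeEdge E L X s a := ⟨hs, hXa, (hD.1 _ _).2 (Or.inl h1), hF,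
          fun h2 => hD.2 _ _ h1 (hFD _ _ h2)⟩
        exact ⟨a, Or.inr ⟨by simpa using ⟨a, hfree, h1⟩, hfree⟩, .refl⟩
    · exact ⟨s, Or.inl rfl, .single (Or.inr h1)⟩
  obtain ⟨q, hq, hbq⟩ : ∃ q, (q = t ∨ (decide (∃ a, freeEdge E L X t a ∧ D t a) = false ∧
      freeEdge E L X t q)) ∧ Joins (fixedArcs E L) A b q := by
    rcases hbt with rfl | ⟨ht, hb, h1 | h1⟩
    · exact ⟨b, Or.inl rfl, .refl⟩
    · by_cases hF : fixedArcs E L b t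
      · exact ⟨t, Or.inl rfl, .single (Or.inl hF)⟩
      · have hfree : freeEdge E L X t b := ⟨ht, hb, (hD.1 _ _).2 (Or.inr h1),
          fun h2 => hD.2 _ _ h1 (hFD _ _ h2), hF⟩
        refine ⟨b, Or.inr ⟨?_, hfree⟩, .refl⟩
        rw [decide_eq_false_iff_not]
        rintro ⟨z, hz, hz'⟩
        obtain rfl := huniq _ _ _ hfree hz
        exact hD.2 _ _ h1 hz'
    · exact ⟨t, Or.inl rfl, .single (Or.inr h1)⟩
  exact ⟨p, q, hp, hq, hpa.trans (hab.trans hbq)⟩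

end Mixed

/-! ### 2-satisfiability -/

section TwoSat

variable {V : Type*}

/-- The complementary literal; the literal `(v, b)` says that the variable `v` has the value
`b`. -/
def compl (l : V × Bool) : V × Bool := (l.1, !l.2)

@[simp]
theorem compl_compl (l : V × Bool) : compl (compl l) = l := by
  simp [compl]

/-- An assignment respects the implications of a transitive, contraposition-closed relation on
literals as soon as no variable is equivalent to its negation: it is read off from a maximal
consistent set of literals that is closed under implication. -/
theorem exists_assignment [Finite V] {P : V × Bool → V × Bool → Prop}
    (htrans : ∀ a b c, P a b → P b c → P a c) (hcompl : ∀ a b, P a b → P (compl b) (compl a))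
    (hbad : ∀ l, P l (compl l) → ¬ P (compl l) l) :
    ∃ β : V → Bool, ∀ u v b c, P (u, b) (v, c) → β u = b → β v = c := by
  classical
  let good : Set (Set (V × Bool)) :=
    {S | (∀ a b, a ∈ S → P a b → b ∈ S) ∧ ∀ a, a ∈ S → compl a ∉ S}
  obtain ⟨S, hS⟩ := (Set.toFinite good).exists_maximal ⟨∅, by simp [good]⟩
  obtain ⟨hclosed, hcons⟩ := hS.prop
  have htotal : ∀ l : V × Bool, l ∈ S ∨ compl l ∈ S := by
    by_contra! hcon
    obtain ⟨l, hl, hl'⟩ := hcon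
    wlog hP : ¬ P l (compl l) generalizing l
    · rw [not_not] at hP
      exact this (compl l) hl' (by simpa using hl) (by simpa using hbad l hP)
    have hmem : insert l {m | P l m} ∪ S ∈ good := by
      have key : ∀ m, (m = l ∨ P l m) → compl m ∉ S := by
        rintro m (rfl | hm) hmS
        · exact hl' hmS
        · exact hl' (hclosed _ _ hmS (hcompl _ _ hm))
      refine ⟨?_, ?_⟩
      · rintro a b ((rfl | ha) | ha) hab
        · exact Or.inl (Or.inr hab)
        · exact Or.inl (Or.inr (htrans _ _ _ ha hab))
        · exact Or.inr (hclosed _ _ ha hab)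
      · rintro a (ha | ha) (ha' | ha')
        · rcases ha with rfl | ha <;> rcases ha' with h1 | ha'
          · simp [compl, Prod.ext_iff] at h1
          · exact hP ha'
          · subst h1
            simp only [compl_compl] at hP
            exact hP ha
          · exact hP (htrans _ _ _ ha (by simpa using hcompl _ _ ha'))
        · exact key _ ha ha'
        · exact key _ ha' (by simpa using ha)
        · exact hcons _ ha ha'
    exact hl (hS.le_of_ge hmem (Set.subset_union_right) (Or.inl (Or.inl rfl)))
  refine ⟨fun v => decide ((v, true) ∈ S), fun u v b c h hu => ?_⟩
  have hu' : (u, b) ∈ S := by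
    cases b with
    | true => simpa using hu
    | false => exact (htotal (u, true)).resolve_left (by simpa using hu)
  have hv := hclosed _ _ hu' h
  cases c with
  | true => simpa using hv
  | false => simpa [compl] using hcons _ hv

/-- The implications expressing that `Lk s t (β s) (β t)` holds for all pairs `(s, t)` of `T`. -/
def Implies (T : V → V → Prop) (Lk : V → V → Bool → Bool → Prop) (a b : V × Bool) : Prop :=
  (T a.1 b.1 ∧ ¬ Lk a.1 b.1 a.2 (!b.2)) ∨ (T b.1 a.1 ∧ ¬ Lk b.1 a.1 (!b.2) a.2)

/-- Binary constraints are satisfiable iff no variable is equivalent to its negation. -/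
theorem exists_forall_iff_transGen [Finite V] (T : V → V → Prop)
    (Lk : V → V → Bool → Bool → Prop) :
    (∃ β : V → Bool, ∀ s t, T s t → Lk s t (β s) (β t)) ↔
      ¬ ∃ v, Relation.TransGen (Implies T Lk) (v, false) (v, true) ∧
        Relation.TransGen (Implies T Lk) (v, true) (v, false) := by
  constructor
  · rintro ⟨β, hβ⟩ ⟨v, h1, h2⟩
    have key : ∀ a b, Relation.TransGen (Implies T Lk) a b → β a.1 = a.2 → β b.1 = b.2 := by
      have step : ∀ a b, Implies T Lk a b → β a.1 = a.2 → β b.1 = b.2 := by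
        rintro ⟨u, b⟩ ⟨v, c⟩ h hu
        by_contra hv
        have hv' : β v = !c := by
          simpa using Bool.eq_not_of_ne hv
        simp only at hu
        rcases h with ⟨h1, h2⟩ | ⟨h1, h2⟩
        · exact h2 (by simpa [hu, hv'] using hβ _ _ h1)
        · exact h2 (by simpa [hu, hv'] using hβ _ _ h1)
      intro a b h
      induction h with
      | single h => exact step _ _ h
      | tail _ h ih => exact fun ha => step _ _ h (ih ha)
    cases hv : β v
    · have := key _ _ h1 hv
      simp [hv] at this
    · have := key _ _ h2 hv
      simp [hv] at this
  · intro h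
    have hcompl : ∀ a b, Implies T Lk a b → Implies T Lk (compl b) (compl a) := by
      rintro a b (h | h)
      · exact Or.inr (by simpa [compl] using h)
      · exact Or.inl (by simpa [compl] using h)
    have hcompl' : ∀ a b, Relation.TransGen (Implies T Lk) a b →
        Relation.TransGen (Implies T Lk) (compl b) (compl a) := by
      intro a b hab
      induction hab with
      | single h => exact .single (hcompl _ _ h)
      | tail _ h ih => exact .head (hcompl _ _ h) ih
    obtain ⟨β, hβ⟩ := exists_assignment (P := Relation.TransGen (Implies T Lk))
      (fun _ _ _ => Relation.TransGen.trans) hcompl' <| by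
        rintro ⟨v, b⟩ h1 h2
        cases b
        · exact h ⟨v, h1, h2⟩
        · exact h ⟨v, h2, h1⟩
    refine ⟨β, fun s t hst => ?_⟩
    by_contra hn
    have := hβ s t (β s) (!β t) (.single (Or.inl ⟨hst, by simpa using hn⟩)) rfl
    simp at this

end TwoSat

/-! ### Timed executions -/

/-- From the state `s` the program `p` halts within `T` steps, in a state that satisfies `Q`. -/
def Exec (p : Program) (s : State) (T : ℕ) (Q : State → Prop) : Prop :=
  ∃ s' t, Runs p s s' t ∧ t ≤ T ∧ Q s'

section Exec

variable {p q : Program} {s : State} {T T' : ℕ} {Q Q' : State → Prop} {i : ℕ}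

theorem Exec.mono (h : Exec p s T Q) (hT : T ≤ T') (hQ : ∀ s', Q s' → Q' s') : Exec p s T' Q' := by
  obtain ⟨s', t, h1, h2, h3⟩ := h
  exact ⟨s', t, h1, h2.trans hT, hQ _ h3⟩

theorem Exec.imp (h : Exec p s T Q) (hQ : ∀ s', Q s' → Q' s') : Exec p s T Q' :=
  h.mono le_rfl hQ

theorem Exec.skip (h : Q s) : Exec .skip s 1 Q :=
  ⟨s, 1, .skip s, le_rfl, h⟩

theorem Exec.instr {a : Instr} (h : Q (a.apply s)) : Exec (.instr a) s 1 Q :=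
  ⟨_, 1, .instr a s, le_rfl, h⟩

theorem Exec.seq (h : Exec p s T fun s' => Exec q s' T' Q) : Exec (.seq p q) s (T + T') Q := by
  obtain ⟨s', t, h1, h2, s'', t', h3, h4, h5⟩ := h
  exact ⟨s'', t + t', .seq h1 h3, by omega, h5⟩

theorem Exec.seq_of (h : Exec p s T Q) (h' : ∀ s', Q s' → Exec q s' T' Q') :
    Exec (.seq p q) s (T + T') Q' :=
  (h.imp h').seq

theorem Exec.ite (h : s.reg i ≠ 0 → Exec p s T Q) (h' : s.reg i = 0 → Exec q s T' Q) :
    Exec (.ite i p q) s (T + T' + 1) Q := by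
  by_cases hi : s.reg i = 0
  · obtain ⟨s', t, h1, h2, h3⟩ := h' hi
    exact ⟨s', t + 1, .ite_false hi h1, by omega, h3⟩
  · obtain ⟨s', t, h1, h2, h3⟩ := h hi
    exact ⟨s', t + 1, .ite_true hi h1, by omega, h3⟩

theorem Exec.loop_done (h : s.reg i = 0) (hQ : Q s) : Exec (.loop i p) s 1 Q :=
  ⟨s, 1, .loop_done h, le_rfl, hQ⟩

theorem Exec.loop_step (hi : s.reg i ≠ 0) (h : Exec p s T fun s' => Exec (.loop i p) s' T' Q) :
    Exec (.loop i p) s (T + T' + 1) Q := by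
  obtain ⟨s', t, h1, h2, s'', t', h3, h4, h5⟩ := h
  exact ⟨s'', t + t' + 1, .loop_step hi h1 h3, by omega, h5⟩

/-- A loop with `N` iterations; the first argument of the invariant counts those still to come. -/
theorem Exec.loop (I : ℕ → State → Prop) (N : ℕ) (hs : I N s)
    (h0 : ∀ s, I 0 s → s.reg i = 0)
    (hstep : ∀ j s, j < N → I (j + 1) s → s.reg i ≠ 0 ∧ Exec p s T (I j)) :
    Exec (.loop i p) s (N * (T + 1) + 1) (I 0) := by
  induction N generalizing s with
  | zero => exact (Exec.loop_done (h0 s hs) hs).mono (by omega) fun _ => id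
  | succ N ih =>
    obtain ⟨h1, h2⟩ := hstep N s (Nat.lt_succ_self N) hs
    refine (Exec.loop_step h1 (h2.imp fun s' hs' =>
      ih hs' fun j s hj => hstep j s (hj.trans (Nat.lt_succ_self N)))).mono ?_ fun _ => id
    ring_nf
    omega

end Exec

/-- `rᵢ := c`. -/
abbrev rconst (i c : ℕ) : Program := .instr (.const i c)
/-- `rᵢ := rⱼ + rₖ`. -/
abbrev radd (i j k : ℕ) : Program := .instr (.add i j k)
/-- `rᵢ := rⱼ - rₖ`. -/
abbrev rsub (i j k : ℕ) : Program := .instr (.sub i j k)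
/-- `rᵢ := mem[rⱼ]`. -/
abbrev rload (i j : ℕ) : Program := .instr (.load i j)
/-- `mem[rᵢ] := rⱼ`. -/
abbrev rstore (i j : ℕ) : Program := .instr (.store i j)

/-! ### Arrays and counting loops

Throughout, register `1` holds `n`, register `2` holds `0`, register `3` holds `1`, the registers
from `4` to `9` are scratch, and the registers `20 + 3 * d`, `21 + 3 * d`, `22 + 3 * d` hold the
index, the number of iterations to come, and an accumulator of the loop of nesting depth `d`. -/

/-- The address of entry `(u, v)` of the `a`-th of a sequence of `n × n` matrices. The input
occupies the matrices `0`, `1` and `2`. -/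
def addr (n a u v : ℕ) : ℕ := 1 + ((a * n + u) * n + v)

theorem addr_inj {n a a' u u' v v' : ℕ} (hu : u < n) (hu' : u' < n) (hv : v < n) (hv' : v' < n) :
    addr n a u v = addr n a' u' v' ↔ a = a' ∧ u = u' ∧ v = v' := by
  have key : ∀ {x x' y y' : ℕ}, y < n → y' < n → x * n + y = x' * n + y' → x = x' ∧ y = y' := by
    intro x x' y y' hy hy' h
    have hn : 0 < n := by omega
    have h1 : ∀ {x y}, y < n → (x * n + y) / n = x := fun {x y} hy => by
      rw [mul_comm, Nat.mul_add_div hn, Nat.div_eq_of_lt hy, add_zero]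
    have h2 : x = x' := by rw [← h1 hy (x := x), h, h1 hy']
    subst h2
    exact ⟨rfl, by omega⟩
  constructor
  · intro h
    obtain ⟨h1, h2⟩ := key hv hv' (by simpa [addr] using h)
    obtain ⟨h3, h4⟩ := key hu hu' h1
    exact ⟨h3, h4, h2⟩
  · rintro ⟨rfl, rfl, rfl⟩
    rfl

/-- The conventions on the registers `1`, `2` and `3`. -/
structure Base (n : ℕ) (s : State) : Prop where
  size : s.reg 1 = n
  zero : s.reg 2 = 0
  one : s.reg 3 = 1

/-- The registers that code at loop depth `d` must leave alone have the same contents. -/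
def Keep (d : ℕ) (s s' : State) : Prop :=
  ∀ r, (r < 4 ∨ 10 ≤ r) → r < 20 + 3 * d → s'.reg r = s.reg r

theorem Keep.trans {d : ℕ} {s s' s'' : State} (h : Keep d s s') (h' : Keep d s' s'') :
    Keep d s s'' :=
  fun r h1 h2 => (h' r h1 h2).trans (h r h1 h2)

theorem Keep.of_le {d d' : ℕ} {s s' : State} (h : Keep d s s') (hd : d' ≤ d) : Keep d' s s' :=
  fun r h1 h2 => h r h1 (by omega)

theorem Keep.base {d n : ℕ} {s s' : State} (h : Keep d s s') (hs : Base n s) : Base n s' :=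
  ⟨(h 1 (by omega) (by omega)).trans hs.1, (h 2 (by omega) (by omega)).trans hs.2,
    (h 3 (by omega) (by omega)).trans hs.3⟩

/-- Only scratch registers have changed. -/
theorem Keep.of_scratch {d : ℕ} {s s' : State} (h : ∀ r, r < 4 ∨ 10 ≤ r → s'.reg r = s.reg r) :
    Keep d s s' :=
  fun r h1 _ => h r h1

/-- Puts the address of entry `(rᵢ, rⱼ)` of matrix `a` into register `5`. -/
def addrProg (a i j : ℕ) : Program :=
  radd 5 j 3 ;; radd 6 i 2 ;; rconst 7 a ;;
  Program.loop 7 (radd 6 6 1 ;; rsub 7 7 3) ;; Program.loop 6 (radd 5 5 1 ;; rsub 6 6 3)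

/-- A bound for the number of steps of `addrProg`. -/
def addrCost (a n : ℕ) : ℕ := 3 * (a + (a + 1) * n) + 5

theorem addrProg_exec {n a i j : ℕ} {s : State} (hs : Base n s) (hi : 10 ≤ i)
    (hin : s.reg i < n) :
    Exec (addrProg a i j) s (addrCost a n) fun s' => s'.mem = s.mem ∧
      s'.reg 5 = addr n a (s.reg i) (s.reg j) ∧ ∀ r, (r < 5 ∨ 10 ≤ r) → s'.reg r = s.reg r := by
  obtain ⟨h1, h2, h3⟩ := hs
  refine Exec.mono (T := 1 + (1 + (1 + ((a * (1 + 1 + 1) + 1) +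
    ((a * n + s.reg i) * (1 + 1 + 1) + 1))))) ?_ ?_ fun _ h => h
  · refine Exec.seq (.instr (.seq (.instr (.seq (.instr (.seq ?_))))))
    refine (Exec.loop (fun k s' => s'.mem = s.mem ∧ s'.reg 5 = s.reg j + 1 ∧
      s'.reg 6 + k * n = a * n + s.reg i ∧ s'.reg 7 = k ∧
      ∀ r, (r < 5 ∨ 10 ≤ r) → s'.reg r = s.reg r) a ?_ (fun s' h => h.2.2.2.1) ?_).imp ?_
    · refine ⟨rfl, ?_, ?_, ?_, ?_⟩
      · simp [Instr.apply, h3]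
      · simp (disch := omega) [Instr.apply, h2, Function.update_of_ne, add_comm]
      · simp [Instr.apply]
      · intro r hr
        simp (disch := omega) [Instr.apply, Function.update_of_ne]
    · rintro k s' - ⟨g1, g2, g3, g4, g5⟩
      refine ⟨by omega, .seq (.instr (.instr ⟨g1, ?_, ?_, ?_, ?_⟩))⟩
      · simpa [Instr.apply] using g2
      · have := g5 1 (by omega)
        simp [Instr.apply, this, h1]
        linarith
      · have := g5 3 (by omega)
        simp [Instr.apply, this, h3, g4]
      · intro r hr
        rw [← g5 r hr]
        simp (disch := omega) [Instr.apply, Function.update_of_ne]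
    · rintro s' ⟨g1, g2, g3, -, g5⟩
      refine (Exec.loop (fun k s' => s'.mem = s.mem ∧ s'.reg 5 + k * n = addr n a (s.reg i) (s.reg j)
        ∧ s'.reg 6 = k ∧ ∀ r, (r < 5 ∨ 10 ≤ r) → s'.reg r = s.reg r) (a * n + s.reg i) ?_
        (fun s' h => h.2.2.1) ?_).imp ?_
      · refine ⟨g1, ?_, by omega, g5⟩
        rw [g2, addr]
        ring
      · rintro k s' - ⟨g1, g2, g3, g5⟩
        refine ⟨by omega, .seq (.instr (.instr ⟨g1, ?_, ?_, ?_⟩))⟩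
        · have := g5 1 (by omega)
          simp [Instr.apply, this, h1]
          linarith
        · have := g5 3 (by omega)
          simp [Instr.apply, this, h3, g3]
        · intro r hr
          rw [← g5 r hr]
          simp (disch := omega) [Instr.apply, Function.update_of_ne]
      · rintro s' ⟨g1, g2, -, g5⟩
        exact ⟨g1, by omega, g5⟩
  · rw [addrCost]
    have : (a + 1) * n = a * n + n := by ring
    omega

/-- The loop of depth `d`: its index runs through `0, …, n - 1`. -/
def forProg (d : ℕ) (p : Program) : Program :=
  rconst (20 + 3 * d) 0 ;; radd (21 + 3 * d) 1 2 ;;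
  Program.loop (21 + 3 * d) (p ;; radd (20 + 3 * d) (20 + 3 * d) 3 ;;
    rsub (21 + 3 * d) (21 + 3 * d) 3)

/-- The invariant `J` of a counting loop depends on the index, the memory and the accumulator. -/
theorem forProg_exec {n d T : ℕ} {p : Program} {s₀ : State} (hs : Base n s₀)
    (J : ℕ → (ℕ → ℕ) → ℕ → Prop) (h0 : J 0 s₀.mem (s₀.reg (22 + 3 * d)))
    (hstep : ∀ i s, i < n → Keep d s₀ s → s.reg (20 + 3 * d) = i →
      J i s.mem (s.reg (22 + 3 * d)) → Exec p s T fun s' => Keep d s s' ∧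
        s'.reg (20 + 3 * d) = s.reg (20 + 3 * d) ∧ s'.reg (21 + 3 * d) = s.reg (21 + 3 * d) ∧
        J (i + 1) s'.mem (s'.reg (22 + 3 * d))) :
    Exec (forProg d p) s₀ (n * (T + 3) + 3) fun s' =>
      Keep d s₀ s' ∧ J n s'.mem (s'.reg (22 + 3 * d)) := by
  refine Exec.mono (T := 1 + (1 + (n * (T + (1 + 1) + 1) + 1))) ?_ (by ring_nf; omega) fun _ h => h
  refine Exec.seq (.instr (.seq (.instr ?_)))
  refine (Exec.loop (fun k s => k ≤ n ∧ Keep d s₀ s ∧ s.reg (20 + 3 * d) + k = n ∧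
    s.reg (21 + 3 * d) = k ∧ J (n - k) s.mem (s.reg (22 + 3 * d))) n ?_ (fun s h => h.2.2.2.1)
    ?_).imp fun s h => ⟨h.2.1, by simpa using h.2.2.2.2⟩
  · refine ⟨le_rfl, ?_, ?_, ?_, ?_⟩
    · intro r h1 h2
      simp (disch := omega) [Instr.apply, Function.update_of_ne]
    · simp (disch := omega) [Instr.apply, Function.update_of_ne]
    · simp (disch := omega) [Instr.apply, Function.update_of_ne, hs.size, hs.zero]
    · simpa (disch := omega) [Instr.apply, Function.update_of_ne] using h0
  · rintro k s hk ⟨h1, h2, h3, h4, h5⟩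
    refine ⟨by omega, (hstep (n - (k + 1)) s (by omega) h2 (by omega) h5).seq_of ?_⟩
    rintro s' ⟨g1, g2, g3, g4⟩
    have hb := (h2.trans g1).base hs
    refine .seq (.instr (.instr ⟨by omega, ?_, ?_, ?_, ?_⟩))
    · intro r hr1 hr2
      rw [← (h2.trans g1) r hr1 hr2]
      simp (disch := omega) [Instr.apply, Function.update_of_ne]
    · simp (disch := omega) [Instr.apply, Function.update_of_ne, hb.one]
      omega
    · simp (disch := omega) [Instr.apply, Function.update_of_ne, hb.one]
      omega
    · have : n - (k + 1) + 1 = n - k := by omega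
      rw [this] at g4
      simpa (disch := omega) [Instr.apply, Function.update_of_ne] using g4

/-- A double loop that overwrites the matrix `b` entry by entry, making exactly the entries with
`val` nonzero. -/
theorem forProg_forProg_exec {n d b T : ℕ} {p : Program} {s₀ : State} (hs : Base n s₀)
    (val : Fin n → Fin n → Prop)
    (hstep : ∀ (u v : Fin n) s, Keep d s₀ s → s.reg (20 + 3 * d) = u →
      s.reg (20 + 3 * (d + 1)) = v →
      (∀ a, a ≠ b → ∀ u v : Fin n, s.mem (addr n a u v) = s₀.mem (addr n a u v)) →
      Exec p s T fun s' => Keep (d + 2) s s' ∧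
        ∃ c, s'.mem = Function.update s.mem (addr n b u v) c ∧ (c ≠ 0 ↔ val u v)) :
    Exec (forProg d (forProg (d + 1) p)) s₀ (n * (n * (T + 3) + 3 + 3) + 3) fun s' =>
      Keep d s₀ s' ∧
      (∀ a, a ≠ b → ∀ u v : Fin n, s'.mem (addr n a u v) = s₀.mem (addr n a u v)) ∧
      ∀ u v : Fin n, s'.mem (addr n b u v) ≠ 0 ↔ val u v := by
  have hinj : ∀ (a : ℕ) (u v u' v' : Fin n), addr n a u v = addr n b u' v' ↔
      a = b ∧ u = u' ∧ v = v' := fun a u v u' v' => by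
    rw [addr_inj u.2 u'.2 v.2 v'.2, Fin.ext_iff, Fin.ext_iff]
  let J : ℕ → ℕ → (ℕ → ℕ) → ℕ → Prop := fun i j m _ =>
    (∀ a, a ≠ b → ∀ u v : Fin n, m (addr n a u v) = s₀.mem (addr n a u v)) ∧
    ∀ u v : Fin n, (u < i ∨ (u : ℕ) = i ∧ (v : ℕ) < j) → (m (addr n b u v) ≠ 0 ↔ val u v)
  refine (forProg_exec hs (fun i => J i 0) ⟨fun _ _ _ _ => rfl, ?_⟩ ?_).imp ?_
  · intro u v h
    omega
  · intro i s hi hk hreg hJ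
    refine (forProg_exec (d := d + 1) (T := T) (hk.base hs) (J i) hJ ?_).imp ?_
    · intro j s' hj hk' hreg' hJ'
      have hk'' := hk'.of_le (Nat.le_succ d)
      have hr : s'.reg (20 + 3 * d) = i := by
        rw [hk' _ (by omega) (by omega), hreg]
      refine (hstep ⟨i, hi⟩ ⟨j, hj⟩ s' (hk.trans hk'') hr hreg' hJ'.1).imp ?_
      rintro s'' ⟨g1, c, g2, g3⟩
      refine ⟨g1.of_le (by omega), g1 _ (by omega) (by omega), g1 _ (by omega) (by omega), ?_, ?_⟩
      · intro a ha u v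
        rw [g2, Function.update_of_ne, hJ'.1 a ha]
        rw [ne_eq, hinj a u v ⟨i, hi⟩ ⟨j, hj⟩]
        exact fun h => ha h.1
      · intro u v huv
        by_cases h : u = ⟨i, hi⟩ ∧ v = ⟨j, hj⟩
        · obtain ⟨rfl, rfl⟩ := h
          simpa [g2] using g3
        · rw [g2, Function.update_of_ne]
          · refine hJ'.2 u v ?_
            rw [Fin.ext_iff, Fin.ext_iff] at h
            simp only at h
            omega
          · rw [ne_eq, hinj b u v ⟨i, hi⟩ ⟨j, hj⟩]
            exact fun h' => h h'.2
    · rintro s' ⟨g1, g2, g3⟩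
      refine ⟨g1.of_le (by omega), g1 _ (by omega) (by omega), g1 _ (by omega) (by omega), g2, ?_⟩
      intro u v huv
      refine g3 u v ?_
      omega
  · rintro s' ⟨g1, g2, g3⟩
    exact ⟨g1, g2, fun u v => g3 u v (Or.inl u.2)⟩

/-! ### First-order formulas over matrices -/

/-- First-order formulas over binary relations on `{0, …, n - 1}`. Variables are numbered by the
depth of their binder, counted from the outside (de Bruijn levels). -/
inductive Formula where
  /-- falsity -/
  | fls
  /-- the relation with number `a` holds for the variables `i` and `j` -/
  | rel (a i j : ℕ)
  /-- the variables `i` and `j` are equal -/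
  | eq (i j : ℕ)
  /-- negation -/
  | not (φ : Formula)
  /-- conjunction -/
  | and (φ ψ : Formula)
  /-- disjunction -/
  | or (φ ψ : Formula)
  /-- existential quantification over the next variable -/
  | ex (φ : Formula)

/-- An interpretation of all relation symbols. -/
abbrev Rels (n : ℕ) := ℕ → Fin n → Fin n → Prop

namespace Formula

/-- Truth of a formula with the free variables `0, …, d - 1`, whose values are given by `e`. -/
def Sat {n : ℕ} (ρ : Rels n) : ℕ → (ℕ → Fin n) → Formula → Prop
  | _, _, fls => False
  | _, e, rel a i j => ρ a (e i) (e j)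
  | _, e, eq i j => e i = e j
  | d, e, not φ => ¬ φ.Sat ρ d e
  | d, e, and φ ψ => φ.Sat ρ d e ∧ ψ.Sat ρ d e
  | d, e, or φ ψ => φ.Sat ρ d e ∨ ψ.Sat ρ d e
  | d, e, ex φ => ∃ w, φ.Sat ρ (d + 1) (Function.update e d w)

/-- The formula has no free variables but `0, …, d - 1`, and it does not mention the matrix `3`,
which serves as a buffer. -/
def Wf : ℕ → Formula → Prop
  | _, fls => True
  | d, rel a i j => a ≠ 3 ∧ i < d ∧ j < d
  | d, eq i j => i < d ∧ j < d
  | d, not φ => φ.Wf d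
  | d, and φ ψ => φ.Wf d ∧ ψ.Wf d
  | d, or φ ψ => φ.Wf d ∧ ψ.Wf d
  | d, ex φ => φ.Wf (d + 1)

/-- A program that evaluates a formula and leaves its truth value in register `4`. -/
def compile : ℕ → Formula → Program
  | _, fls => rconst 4 0
  | _, rel a i j => addrProg a (20 + 3 * i) (20 + 3 * j) ;; rload 4 5 ;;
      Program.ite 4 (rconst 4 1) (rconst 4 0)
  | _, eq i j => rsub 4 (20 + 3 * i) (20 + 3 * j) ;; rsub 5 (20 + 3 * j) (20 + 3 * i) ;;
      radd 4 4 5 ;; Program.ite 4 (rconst 4 0) (rconst 4 1)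
  | d, not φ => φ.compile d ;; Program.ite 4 (rconst 4 0) (rconst 4 1)
  | d, and φ ψ => φ.compile d ;; Program.ite 4 (ψ.compile d) .skip
  | d, or φ ψ => φ.compile d ;; Program.ite 4 .skip (ψ.compile d)
  | d, ex φ => rconst (22 + 3 * d) 0 ;;
      forProg d (φ.compile (d + 1) ;; Program.ite 4 (rconst (22 + 3 * d) 1) .skip) ;;
      radd 4 (22 + 3 * d) 2

/-- A bound for the number of steps of `compile`. -/
def cost (n : ℕ) : Formula → ℕ
  | fls => 1
  | rel a _ _ => addrCost a n + 4
  | eq _ _ => 6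
  | not φ => φ.cost n + 3
  | and φ ψ => φ.cost n + ψ.cost n + 2
  | or φ ψ => φ.cost n + ψ.cost n + 2
  | ex φ => n * (φ.cost n + 6) + 5

end Formula

/-- The loop indices of depth less than `d` are given by `e`. -/
def Vars {n : ℕ} (d : ℕ) (e : ℕ → Fin n) (s : State) : Prop :=
  ∀ i < d, s.reg (20 + 3 * i) = e i

theorem Vars.of_keep {n d d' : ℕ} {e : ℕ → Fin n} {s s' : State} (h : Vars d e s)
    (hk : Keep d' s s') (hd : d ≤ d') : Vars d e s' :=
  fun i hi => (hk _ (by omega) (by omega)).trans (h i hi)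

theorem Vars.update {n d : ℕ} {e : ℕ → Fin n} {s : State} {w : Fin n} (h : Vars d e s)
    (hw : s.reg (20 + 3 * d) = w) : Vars (d + 1) (Function.update e d w) s := by
  intro i hi
  by_cases h' : i = d
  · subst h'
    simpa using hw
  · rw [Function.update_of_ne h']
    exact h i (by omega)

/-- The memory holds, except for the buffer, the relations `ρ`. -/
def Holds {n : ℕ} (ρ : Rels n) (m : ℕ → ℕ) : Prop :=
  ∀ a, a ≠ 3 → ∀ u v : Fin n, m (addr n a u v) ≠ 0 ↔ ρ a u v

open Classical in
/-- The truth value of `P` as a number. -/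
noncomputable def bit (P : Prop) : ℕ := if P then 1 else 0

@[simp]
theorem bit_eq_zero {P : Prop} : bit P = 0 ↔ ¬ P := by
  by_cases h : P <;> simp [bit, h]

theorem bit_of_true {P : Prop} (h : P) : bit P = 1 := by simp [bit, h]

theorem bit_of_false {P : Prop} (h : ¬ P) : bit P = 0 := by simp [bit, h]

/-- The final states after the evaluation of a condition `P` at depth `d`. -/
def Tested (d : ℕ) (s : State) (P : Prop) (s' : State) : Prop :=
  s'.mem = s.mem ∧ Keep d s s' ∧ s'.reg 4 = bit P

theorem ite_const_exec {d : ℕ} {s s' : State} {P : Prop} {a b : ℕ} (hm : s'.mem = s.mem)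
    (hk : Keep d s s') (ha : s'.reg 4 ≠ 0 → a = bit P) (hb : s'.reg 4 = 0 → b = bit P) :
    Exec (.ite 4 (rconst 4 a) (rconst 4 b)) s' 3 (Tested d s P) := by
  have key : ∀ c, Keep d s ((Instr.const 4 c).apply s') := fun c r h1 h2 => by
    rw [← hk r h1 h2]
    simp (disch := omega) [Instr.apply, Function.update_of_ne]
  refine Exec.ite (T := 1) (T' := 1) (fun h => .instr ⟨hm, key _, ?_⟩)
    (fun h => .instr ⟨hm, key _, ?_⟩)
  · simpa [Instr.apply] using ha h
  · simpa [Instr.apply] using hb h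

theorem Formula.compile_exec {n : ℕ} {ρ : Rels n} (φ : Formula) {d : ℕ} {e : ℕ → Fin n}
    {s : State} (hwf : φ.Wf d) (hs : Base n s) (hv : Vars d e s) (hm : Holds ρ s.mem) :
    Exec (φ.compile d) s (φ.cost n) (Tested d s (φ.Sat ρ d e)) := by
  induction φ generalizing d e s with
  | fls =>
    refine .instr ⟨rfl, .of_scratch fun r hr => ?_, ?_⟩
    · simp (disch := omega) [Instr.apply, Function.update_of_ne]
    · simp [Instr.apply, Sat, bit]
  | rel a i j =>
    obtain ⟨ha, hi, hj⟩ := hwf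
    refine (Exec.seq_of (T' := 1 + 3) (addrProg_exec hs (by omega)
      (by rw [hv i hi]; exact (e i).2)) ?_).mono (by simp [cost]) fun _ h => h
    rintro s' ⟨g1, g2, g3⟩
    rw [hv i hi, hv j hj] at g2
    have hval : s'.mem (s'.reg 5) ≠ 0 ↔ ρ a (e i) (e j) := by
      rw [g1, g2]
      exact hm a ha _ _
    refine .seq (.instr (ite_const_exec g1 ?_ (fun h => ?_) (fun h => ?_)))
    · intro r hr _
      rw [← g3 r (by omega)]
      simp (disch := omega) [Instr.apply, Function.update_of_ne]
    · rw [bit_of_true]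
      exact hval.1 (by simpa [Instr.apply] using h)
    · rw [bit_of_false]
      intro h'
      exact hval.2 h' (by simpa [Instr.apply] using h)
  | eq i j =>
    obtain ⟨hi, hj⟩ := hwf
    have h4 : ∀ c : State, c = (Instr.add 4 4 5).apply
        ((Instr.sub 5 (20 + 3 * j) (20 + 3 * i)).apply
          ((Instr.sub 4 (20 + 3 * i) (20 + 3 * j)).apply s)) →
        c.reg 4 = ((e i : ℕ) - e j) + ((e j : ℕ) - e i) := by
      rintro c rfl
      simp (disch := omega) [Instr.apply, Function.update_of_ne, hv i hi, hv j hj]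
    refine Exec.seq (T := 1) (T' := 1 + (1 + 3)) (.instr (.seq (.instr (.seq (.instr
      (ite_const_exec rfl (.of_scratch fun r hr => ?_) (fun h => ?_) fun h => ?_))))))
    · simp (disch := omega) [Instr.apply, Function.update_of_ne]
    · rw [h4 _ rfl] at h
      rw [bit_of_false]
      simp only [Sat, Fin.ext_iff]
      omega
    · rw [h4 _ rfl] at h
      rw [bit_of_true]
      simp only [Sat, Fin.ext_iff]
      omega
  | not φ ih =>
    refine (ih hwf hs hv hm).seq_of ?_
    rintro s' ⟨g1, g2, g3⟩
    refine ite_const_exec g1 g2 (fun h => ?_) (fun h => ?_)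
    · rw [bit_of_false]
      simpa [g3, Sat] using h
    · rw [bit_of_true]
      simpa [g3, Sat] using h
  | and φ ψ ihφ ihψ =>
    refine ((ihφ hwf.1 hs hv hm).seq_of (T' := ψ.cost n + 1 + 1) ?_).mono
      (by simp only [cost]; omega) fun _ h => h
    rintro s' ⟨g1, g2, g3⟩
    refine .ite (fun h => ?_) (fun h => .skip ⟨g1, g2, ?_⟩)
    · refine (ihψ hwf.2 (g2.base hs) (hv.of_keep g2 le_rfl) (g1 ▸ hm)).imp ?_
      rintro s'' ⟨k1, k2, k3⟩
      refine ⟨k1.trans g1, g2.trans k2, ?_⟩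
      rw [k3]
      have : φ.Sat ρ d e := by simpa [g3] using h
      simp [Sat, this]
    · rw [h, eq_comm, bit_eq_zero]
      rw [g3, bit_eq_zero] at h
      exact fun h' => h h'.1
  | or φ ψ ihφ ihψ =>
    refine ((ihφ hwf.1 hs hv hm).seq_of (T' := 1 + ψ.cost n + 1) ?_).mono
      (by simp only [cost]; omega) fun _ h => h
    rintro s' ⟨g1, g2, g3⟩
    refine .ite (fun h => .skip ⟨g1, g2, ?_⟩) (fun h => ?_)
    · have : φ.Sat ρ d e := by simpa [g3] using h
      rw [g3, bit_of_true this, bit_of_true]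
      exact Or.inl this
    · refine (ihψ hwf.2 (g2.base hs) (hv.of_keep g2 le_rfl) (g1 ▸ hm)).imp ?_
      rintro s'' ⟨k1, k2, k3⟩
      refine ⟨k1.trans g1, g2.trans k2, ?_⟩
      rw [k3]
      have : ¬ φ.Sat ρ d e := by simpa [g3] using h
      simp [Sat, this]
  | ex φ ih =>
    let s₁ := (Instr.const (22 + 3 * d) 0).apply s
    have hk₁ : Keep d s s₁ := fun r h1 h2 => by
      simp (disch := omega) [s₁, Instr.apply, Function.update_of_ne]
    refine Exec.mono (T := 1 + ((n * ((φ.cost n + (1 + 1 + 1)) + 3) + 3) + 1)) (.seq (.instr (.seq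
      ((forProg_exec (hk₁.base hs) (fun i m acc => m = s.mem ∧
        acc = bit (∃ w : Fin n, (w : ℕ) < i ∧ φ.Sat ρ (d + 1) (Function.update e d w)))
        ⟨rfl, ?_⟩ ?_).imp ?_)))) (by simp only [cost]; ring_nf; omega) fun _ h => h
    · simp [s₁, Instr.apply, bit]
    · rintro i s' hi hk hreg ⟨hmem, hacc⟩
      have hk' := hk₁.trans hk
      refine (ih (e := Function.update e d ⟨i, hi⟩) hwf (hk'.base hs)
        ((hv.of_keep hk' le_rfl).update hreg) (hmem ▸ hm)).seq_of ?_
      rintro s'' ⟨g1, g2, g3⟩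
      have hlt : ∀ w : Fin n, (w : ℕ) < i + 1 ↔ (w : ℕ) < i ∨ w = ⟨i, hi⟩ := fun w => by
        rw [Fin.ext_iff, Nat.lt_succ_iff_lt_or_eq]
      refine .ite (fun h => .instr ?_) (fun h => .skip ?_)
      · refine ⟨?_, ?_, ?_, ?_, ?_⟩
        · intro r h1 h2
          rw [← g2 r h1 (by omega)]
          simp (disch := omega) [Instr.apply, Function.update_of_ne]
        · rw [← g2 (20 + 3 * d) (by omega) (by omega)]
          simp (disch := omega) [Instr.apply, Function.update_of_ne]
        · rw [← g2 (21 + 3 * d) (by omega) (by omega)]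
          simp (disch := omega) [Instr.apply, Function.update_of_ne]
        · exact g1.trans hmem
        · rw [bit_of_true]
          · simp [Instr.apply]
          · exact ⟨⟨i, hi⟩, Nat.lt_succ_self i, by simpa [g3] using h⟩
      · refine ⟨g2.of_le (by omega), g2 _ (by omega) (by omega), g2 _ (by omega) (by omega),
          g1.trans hmem, ?_⟩
        rw [g2 _ (by omega) (by omega), hacc]
        rw [g3, bit_eq_zero] at h
        congr 1
        refine propext (exists_congr fun w => ?_)
        rw [hlt]
        constructor
        · exact fun h' => ⟨Or.inl h'.1, h'.2⟩
        · rintro ⟨h1 | rfl, h2⟩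
          exacts [⟨h1, h2⟩, absurd h2 h]
    · rintro s' ⟨g1, g2, g3⟩
      have hk := hk₁.trans g1
      refine .instr ⟨g2, ?_, ?_⟩
      · intro r h1 h2
        rw [← hk r h1 h2]
        simp (disch := omega) [Instr.apply, Function.update_of_ne]
      · have := (hk.base hs).zero
        simp [Instr.apply, g3, this, Sat]

/-! ### Loop programs over matrices -/

/-- Programs that transform relations. -/
inductive Stmt where
  /-- replace the relation `a` by the one that a formula defines in terms of the old relations; the
  next two variables of the formula are bound to the row and the column -/
  | assign (a : ℕ) (φ : Formula)
  /-- first `S`, then `S'` -/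
  | seq (S S' : Stmt)
  /-- execute `S` for all values of the next variable -/
  | forEach (S : Stmt)

namespace Stmt

/-- The effect of a statement inside `d` loops, whose indices are given by `e`. -/
def run {n : ℕ} : ℕ → (ℕ → Fin n) → Stmt → Rels n → Rels n
  | d, e, assign a φ, ρ => Function.update ρ a fun u v =>
      φ.Sat ρ (d + 2) (Function.update (Function.update e d u) (d + 1) v)
  | d, e, seq S S', ρ => S'.run d e (S.run d e ρ)
  | d, e, forEach S, ρ =>
      (List.finRange n).foldl (fun ρ w => S.run (d + 1) (Function.update e d w) ρ) ρ

/-- All formulas are well-formed, and the buffer `3` is not assigned to. -/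
def Wf : ℕ → Stmt → Prop
  | d, assign a φ => a ≠ 3 ∧ φ.Wf (d + 2)
  | d, seq S S' => S.Wf d ∧ S'.Wf d
  | d, forEach S => S.Wf (d + 1)

/-- The statement assigns to the relation `a`. -/
def Writes (a : ℕ) : Stmt → Prop
  | assign b _ => a = b
  | seq S S' => S.Writes a ∨ S'.Writes a
  | forEach S => S.Writes a

/-- The translation into a program of the machine. The values of the formula of an assignment are
collected in the buffer before they overwrite the old relation. -/
def compile : ℕ → Stmt → Program
  | d, assign a φ =>
      forProg d (forProg (d + 1) (φ.compile (d + 2) ;;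
        addrProg 3 (20 + 3 * d) (20 + 3 * (d + 1)) ;; rstore 5 4)) ;;
      forProg d (forProg (d + 1) (addrProg 3 (20 + 3 * d) (20 + 3 * (d + 1)) ;; rload 4 5 ;;
        addrProg a (20 + 3 * d) (20 + 3 * (d + 1)) ;; rstore 5 4))
  | d, seq S S' => S.compile d ;; S'.compile d
  | d, forEach S => forProg d (S.compile (d + 1))

/-- A bound for the number of steps of `compile`. -/
def cost (n : ℕ) : Stmt → ℕ
  | assign a φ => (n * (n * (φ.cost n + (addrCost 3 n + 1) + 3) + 3 + 3) + 3) +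
      (n * (n * (addrCost 3 n + (1 + (addrCost a n + 1)) + 3) + 3 + 3) + 3)
  | seq S S' => S.cost n + S'.cost n
  | forEach S => n * (S.cost n + 3) + 3

end Stmt

theorem foldl_finRange_induction {n : ℕ} {α : Type*} (f : α → Fin n → α) (x : α)
    (I : ℕ → α → Prop) (h0 : I 0 x) (hstep : ∀ (i : Fin n) y, I i y → I (i + 1) (f y i)) :
    I n ((List.finRange n).foldl f x) := by
  have key : ∀ i ≤ n, I i (((List.finRange n).take i).foldl f x) := by
    intro i hi
    induction i with
    | zero => simpa using h0
    | succ i ih =>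
      rw [List.take_succ_eq_append_getElem (by simpa using hi), List.foldl_append]
      simpa using hstep ⟨i, hi⟩ _ (ih (by omega))
  have h := key n le_rfl
  rwa [List.take_of_length_le (by simp)] at h

theorem Stmt.run_of_not_writes {n a : ℕ} (S : Stmt) {d : ℕ} {e : ℕ → Fin n} {ρ : Rels n}
    (h : ¬ S.Writes a) : S.run d e ρ a = ρ a := by
  induction S generalizing d e ρ with
  | assign b φ => exact Function.update_of_ne h _ _
  | seq S S' ih ih' => rw [run, ih' fun h' => h (Or.inr h'), ih fun h' => h (Or.inl h')]
  | forEach S ih =>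
    exact foldl_finRange_induction _ ρ (fun _ ρ' => ρ' a = ρ a) rfl fun i ρ' h' => by rw [ih h, h']

theorem Stmt.compile_exec {n : ℕ} (S : Stmt) {ρ : Rels n} {d : ℕ} {e : ℕ → Fin n} {s : State}
    (hwf : S.Wf d) (hs : Base n s) (hv : Vars d e s) (hm : Holds ρ s.mem) :
    Exec (S.compile d) s (S.cost n) fun s' => Keep d s s' ∧ Holds (S.run d e ρ) s'.mem := by
  induction S generalizing ρ d e s with
  | assign a φ =>
    refine Exec.seq ((forProg_forProg_exec (b := 3) hs (fun u v => φ.Sat ρ (d + 2)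
      (Function.update (Function.update e d u) (d + 1) v)) ?_).imp ?_)
    · intro u v s' hk hu hv' hmem
      refine (φ.compile_exec (ρ := ρ) (e := Function.update (Function.update e d u) (d + 1) v)
        hwf.2 (hk.base hs) (((hv.of_keep hk le_rfl).update hu).update hv')
        fun a ha u v => by rw [hmem a ha]; exact hm a ha u v).seq_of ?_
      rintro s₁ ⟨g1, g2, g3⟩
      have hu₁ : s₁.reg (20 + 3 * d) = u := (g2 _ (by omega) (by omega)).trans hu
      have hv₁ : s₁.reg (20 + 3 * (d + 1)) = v := (g2 _ (by omega) (by omega)).trans hv'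
      refine (addrProg_exec (g2.base (hk.base hs)) (by omega)
        (by rw [hu₁]; exact u.2)).seq_of ?_
      rintro s₂ ⟨k1, k2, k3⟩
      refine .instr ⟨g2.trans (.of_scratch fun r hr => k3 r (by omega)), s₁.reg 4, ?_, ?_⟩
      · simp only [Instr.apply]
        rw [k1, g1, k2, k3 4 (by omega), hu₁, hv₁]
      · rw [g3, ne_eq, bit_eq_zero, not_not]
    · rintro s₁ ⟨g1, g2, g3⟩
      have hs₁ := g1.base hs
      refine (forProg_forProg_exec (b := a) hs₁ (fun u v => φ.Sat ρ (d + 2)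
        (Function.update (Function.update e d u) (d + 1) v)) ?_).imp ?_
      · intro u v s' hk hu hv' hmem
        refine (addrProg_exec (hk.base hs₁) (by omega)
          (by rw [hu]; exact u.2)).seq_of ?_
        rintro s₂ ⟨k1, k2, k3⟩
        have hk₂ : Keep (d + 2) s' s₂ := .of_scratch fun r hr => k3 r (by omega)
        refine .seq (.instr ?_)
        set s₃ := (Instr.load 4 5).apply s₂ with hs₃
        have hk₃ : Keep (d + 2) s' s₃ := hk₂.trans (.of_scratch fun r hr => by
          simp (disch := omega) [hs₃, Instr.apply, Function.update_of_ne])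
        have hu₃ : s₃.reg (20 + 3 * d) = u := (hk₃ _ (by omega) (by omega)).trans hu
        have hv₃ : s₃.reg (20 + 3 * (d + 1)) = v := (hk₃ _ (by omega) (by omega)).trans hv'
        have h4 : s₃.reg 4 = s₁.mem (addr n 3 u v) := by
          rw [← hmem 3 hwf.1.symm]
          simp [hs₃, Instr.apply, k2, k1, hu, hv']
        have hm₃ : s₃.mem = s'.mem := k1
        refine (addrProg_exec (hk₃.base (hk.base hs₁)) (by omega)
          (by rw [hu₃]; exact u.2)).seq_of ?_
        rintro s₄ ⟨l1, l2, l3⟩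
        refine .instr ⟨hk₃.trans (.of_scratch fun r hr => l3 r (by omega)), _, ?_, g3 u v⟩
        simp only [Instr.apply]
        rw [l1, l2, l3 4 (by omega), h4, hu₃, hv₃, hm₃]
      · rintro s₂ ⟨k1, k2, k3⟩
        refine ⟨g1.trans k1, fun b hb u v => ?_⟩
        by_cases hba : b = a
        · subst hba
          rw [k3 u v]
          simp [run]
        · rw [k2 b hba, g2 b hb, hm b hb, run, Function.update_of_ne hba]
  | seq S S' ih ih' =>
    refine (ih hwf.1 hs hv hm).seq_of ?_
    rintro s' ⟨g1, g2⟩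
    exact (ih' hwf.2 (g1.base hs) (hv.of_keep g1 le_rfl) g2).imp fun s'' h => ⟨g1.trans h.1, h.2⟩
  | forEach S ih =>
    let f : Rels n → Fin n → Rels n := fun ρ w => S.run (d + 1) (Function.update e d w) ρ
    refine (forProg_exec hs
      (fun i m _ => Holds (((List.finRange n).take i).foldl f ρ) m) (by simpa using hm) ?_).imp ?_
    · intro i s' hi hk hreg hm'
      refine (ih (e := Function.update e d ⟨i, hi⟩) hwf (hk.base hs)
        ((hv.of_keep hk le_rfl).update hreg) hm').imp ?_
      rintro s'' ⟨g1, g2⟩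
      refine ⟨g1.of_le (by omega), g1 _ (by omega) (by omega), g1 _ (by omega) (by omega), ?_⟩
      rw [List.take_succ_eq_append_getElem (by simpa using hi), List.foldl_append]
      simpa [f] using g2
    · rintro s' ⟨g1, g2⟩
      refine ⟨g1, ?_⟩
      rw [List.take_of_length_le (by simp)] at g2
      exact g2

/-! ### Polynomial bounds -/

/-- A function bounded by a polynomial; as `max n 2` is at least `2`, a power of it suffices. -/
def PolyBounded (f : ℕ → ℕ) : Prop := ∃ C, ∀ n, f n ≤ max n 2 ^ C

theorem PolyBounded.const (c : ℕ) : PolyBounded fun _ => c :=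
  ⟨c, fun _ => (Nat.lt_two_pow_self (n := c)).le.trans (Nat.pow_le_pow_left (le_max_right _ _) c)⟩

theorem PolyBounded.id : PolyBounded fun n => n := ⟨1, fun n => by simp⟩

theorem PolyBounded.mul {f g : ℕ → ℕ} (hf : PolyBounded f) (hg : PolyBounded g) :
    PolyBounded fun n => f n * g n := by
  obtain ⟨C, hC⟩ := hf
  obtain ⟨C', hC'⟩ := hg
  exact ⟨C + C', fun n => by rw [pow_add]; exact Nat.mul_le_mul (hC n) (hC' n)⟩

theorem PolyBounded.add {f g : ℕ → ℕ} (hf : PolyBounded f) (hg : PolyBounded g) :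
    PolyBounded fun n => f n + g n := by
  obtain ⟨C, hC⟩ := hf
  obtain ⟨C', hC'⟩ := hg
  refine ⟨C + C' + 1, fun n => ?_⟩
  have h2 : 2 ≤ max n 2 := le_max_right _ _
  have h1 := (hC n).trans (Nat.pow_le_pow_right (by omega) (Nat.le_add_right C C'))
  have h1' := (hC' n).trans (Nat.pow_le_pow_right (n := max n 2) (by omega) (Nat.le_add_left C' C))
  rw [pow_succ]
  nlinarith

theorem addrCost_polyBounded (a : ℕ) : PolyBounded (addrCost a) :=
  ((PolyBounded.const 3).mul ((PolyBounded.const a).add ((PolyBounded.const (a + 1)).mul .id))).add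
    (.const 5)

theorem Formula.cost_polyBounded (φ : Formula) : PolyBounded fun n => φ.cost n := by
  induction φ with
  | fls => exact .const 1
  | rel a i j => exact (addrCost_polyBounded a).add (.const 4)
  | eq i j => exact .const 6
  | not φ ih => exact ih.add (.const 3)
  | and φ ψ ih ih' => exact (ih.add ih').add (.const 2)
  | or φ ψ ih ih' => exact (ih.add ih').add (.const 2)
  | ex φ ih => exact (PolyBounded.id.mul (ih.add (.const 6))).add (.const 5)

theorem Stmt.cost_polyBounded (S : Stmt) : PolyBounded fun n => S.cost n := by
  induction S with
  | assign a φ =>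
    have key : ∀ {f}, PolyBounded f → PolyBounded fun n => n * (n * (f n + 3) + 3 + 3) + 3 :=
      fun hf => (PolyBounded.id.mul (((PolyBounded.id.mul (hf.add (.const 3))).add (.const 3)).add
        (.const 3))).add (.const 3)
    exact (key (φ.cost_polyBounded.add ((addrCost_polyBounded 3).add (.const 1)))).add
      (key ((addrCost_polyBounded 3).add ((PolyBounded.const 1).add
        ((addrCost_polyBounded a).add (.const 1)))))
  | seq S S' ih ih' => exact ih.add ih'
  | forEach S ih => exact (PolyBounded.id.mul (ih.add (.const 3))).add (.const 3)

/-! ### The loop programs for the preprocessing and for the test of a certificate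

The relations are numbered as follows: `0` the edges, `1` the arcs, `2` the terminal pairs, `4` a
reachability relation, `5` the candidate cover `X` (on the diagonal), `6` the certificate, `7` the
free edges, `8` to `11` the implications between literals, `12` the fixed arcs, `13` to `16` the
relation `Linked`. -/

section Warshall

variable {α : Type*} {R S S' : α → α → Prop}

/-- The invariant of Warshall's algorithm: `S` lies between `R` and its transitive closure, and it
is closed under composition through the vertices of `W`. -/
structure WarshallInv (R : α → α → Prop) (W : α → Prop) (S : α → α → Prop) : Prop where
  base : ∀ x y, R x y → S x y
  closure : ∀ x y, S x y → TransGen R x y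
  pivot : ∀ w, W w → ∀ x y, S x w → S w y → S x y

theorem WarshallInv.step {W W' : α → Prop} (h : WarshallInv R W S) (w : α)
    (hS : ∀ x y, S' x y ↔ S x y ∨ S x w ∧ S w y) (hW : ∀ z, W' z → W z ∨ z = w) :
    WarshallInv R W' S' := by
  refine ⟨fun x y hxy => (hS x y).2 (Or.inl (h.base x y hxy)), fun x y hxy => ?_,
    fun z hz x y hxz hzy => ?_⟩
  · rcases (hS x y).1 hxy with h1 | ⟨h1, h2⟩
    · exact h.closure x y h1
    · exact (h.closure x w h1).trans (h.closure w y h2)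
  · rw [hS] at hxz hzy ⊢
    rcases hW z hz with hz | rfl
    · have hp := h.pivot z hz
      rcases hxz with h1 | ⟨h1, h2⟩ <;> rcases hzy with h3 | ⟨h3, h4⟩
      · exact Or.inl (hp _ _ h1 h3)
      · exact Or.inr ⟨hp _ _ h1 h3, h4⟩
      · exact Or.inr ⟨h1, hp _ _ h2 h3⟩
      · exact Or.inr ⟨h1, h4⟩
    · exact Or.inr ⟨hxz.elim id And.left, hzy.elim id And.right⟩

theorem WarshallInv.iff_transGen {W : α → Prop} (h : WarshallInv R W S) (hW : ∀ w, W w) (x y : α) :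
    S x y ↔ TransGen R x y := by
  refine ⟨h.closure x y, fun hxy => ?_⟩
  induction hxy with
  | single h' => exact h.base _ _ h'
  | tail _ h' ih => exact h.pivot _ (hW _) _ _ ih (h.base _ _ h')

end Warshall

open Formula Stmt

/-- Warshall's algorithm for the relation `a`, at loop depth `d`. -/
def warshall (a d : ℕ) : Stmt :=
  forEach (assign a (or (rel a (d + 1) (d + 2)) (and (rel a (d + 1) d) (rel a d (d + 2)))))

variable {n : ℕ}

theorem warshall_run (a d : ℕ) (e : ℕ → Fin n) (ρ : Rels n) (u v : Fin n) :
    (warshall a d).run d e ρ a u v ↔ TransGen (ρ a) u v := by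
  refine WarshallInv.iff_transGen (W := fun w : Fin n => (w : ℕ) < n) ?_ (fun w => w.2) u v
  refine foldl_finRange_induction _ ρ
    (fun i ρ' => WarshallInv (ρ a) (fun w => (w : ℕ) < i) (ρ' a)) ?_ ?_
  · exact ⟨fun _ _ => id, fun _ _ => .single, fun w hw => absurd hw (Nat.not_lt_zero _)⟩
  · intro w ρ' h
    refine h.step w (fun x y => ?_) (fun z hz => ?_)
    · have h2 : d ≠ d + 1 + 1 := by omega
      simp [run, Sat, h2]
    · rw [Fin.ext_iff]
      omega

theorem warshall_run_of_ne {a b : ℕ} (d : ℕ) (e : ℕ → Fin n) (ρ : Rels n) (h : b ≠ a) :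
    (warshall a d).run d e ρ b = ρ b :=
  run_of_not_writes _ h

/-- The pairs of variables `{i, j}` and `{k, l}` are equal. -/
def samePair (i j k l : ℕ) : Formula :=
  or (and (eq i k) (eq j l)) (and (eq i l) (eq j k))

/-- One step of the preprocessing, for the edge between the variables `0` and `1`. -/
def orientStmt : Stmt :=
  seq (assign 4 (or (and (rel 0 2 3) (not (samePair 2 3 0 1))) (or (rel 1 2 3) (eq 2 3))))
  (seq (warshall 4 2)
  (seq (assign 1 (or (rel 1 2 3) (and (and (eq 2 0) (eq 3 1)) (and (rel 0 0 1) (rel 4 1 0)))))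
  (assign 0 (and (rel 0 2 3) (not (and (samePair 2 3 0 1) (and (rel 0 0 1) (rel 4 1 0))))))))

theorem transGen_or_eq_iff {α : Type*} {R : α → α → Prop} {S : α → α → Prop}
    (h : ∀ a b, S a b ↔ R a b ∨ a = b) (x y : α) : TransGen S x y ↔ ReflTransGen R x y := by
  constructor
  · intro hxy
    have step : ∀ a b, S a b → ReflTransGen R a b := fun a b hab => by
      rcases (h a b).1 hab with h' | rfl
      exacts [.single h', .refl]
    induction hxy with
    | single h' => exact step _ _ h'
    | tail _ h' ih => exact ih.trans (step _ _ h')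
  · intro hxy
    induction hxy with
    | refl => exact .single ((h x x).2 (Or.inr rfl))
    | tail _ h' ih => exact ih.tail ((h _ _).2 (Or.inl h'))

theorem orientStmt_run (e : ℕ → Fin n) (ρ : Rels n) :
    orientStmt.run 2 e ρ 0 = orientEdges (ρ 0) (ρ 1) (e 0) (e 1) ∧
    orientStmt.run 2 e ρ 1 = orientArcs (ρ 0) (ρ 1) (e 0) (e 1) := by
  simp only [orientStmt, run]
  set ρ₁ : Rels n := Function.update ρ 4 _ with hρ₁
  have h0 : (warshall 4 2).run 2 e ρ₁ 0 = ρ 0 := by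
    rw [warshall_run_of_ne _ _ _ (by decide), hρ₁, Function.update_of_ne (by decide)]
  have h1 : (warshall 4 2).run 2 e ρ₁ 1 = ρ 1 := by
    rw [warshall_run_of_ne _ _ _ (by decide), hρ₁, Function.update_of_ne (by decide)]
  have h4 : ∀ u v, (warshall 4 2).run 2 e ρ₁ 4 u v ↔
      Joins (deleteEdge (ρ 0) (e 0) (e 1)) (ρ 1) u v := by
    intro u v
    rw [warshall_run, Joins]
    refine transGen_or_eq_iff (fun a b => ?_) u v
    simp [hρ₁, Sat, samePair, deleteEdge, or_assoc]
  constructor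
  · ext a b
    simp [Sat, samePair, h0, h4, orientEdges, OnMixedCycle]
  · ext a b
    simp [Sat, h0, h1, h4, orientArcs, OnMixedCycle]

/-- The preprocessing: orient every edge that lies on a mixed cycle. -/
def preprocess : Stmt := forEach (forEach orientStmt)

theorem preprocess_run (e : ℕ → Fin n) (ρ : Rels n) (hsymm : ∀ a b, ρ 0 a b → ρ 0 b a)
    (hirr : ∀ a, ¬ ρ 0 a a) :
    Reduced (ρ 0) (ρ 1) (ρ 2) (preprocess.run 0 e ρ 0) (preprocess.run 0 e ρ 1) ∧
    ∀ u v, ¬ OnMixedCycle (preprocess.run 0 e ρ 0) (preprocess.run 0 e ρ 1) u v := by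
  have key : Reduced (ρ 0) (ρ 1) (ρ 2) (preprocess.run 0 e ρ 0) (preprocess.run 0 e ρ 1) ∧
      ∀ u v : Fin n, (u : ℕ) < n →
        ¬ OnMixedCycle (preprocess.run 0 e ρ 0) (preprocess.run 0 e ρ 1) u v := by
    refine foldl_finRange_induction _ ρ (fun i ρ' => Reduced (ρ 0) (ρ 1) (ρ 2) (ρ' 0) (ρ' 1) ∧
      ∀ u v : Fin n, (u : ℕ) < i → ¬ OnMixedCycle (ρ' 0) (ρ' 1) u v) ?_ ?_
    · exact ⟨⟨hsymm, hirr, Iff.rfl, fun _ _ => Iff.rfl⟩, fun _ _ h => absurd h (Nat.not_lt_zero _)⟩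
    · intro i ρ' h
      have inner := foldl_finRange_induction
        (fun ρ w => orientStmt.run 2 (Function.update (Function.update e 0 i) 1 w) ρ) ρ'
        (fun j ρ' => Reduced (ρ 0) (ρ 1) (ρ 2) (ρ' 0) (ρ' 1) ∧
          ∀ u v : Fin n, ((u : ℕ) < i ∨ u = i ∧ (v : ℕ) < j) → ¬ OnMixedCycle (ρ' 0) (ρ' 1) u v)
        ⟨h.1, fun u v h' => h.2 u v (by simpa using h')⟩ (by
          intro j ρ'' h''
          have h1 := orientStmt_run (Function.update (Function.update e 0 i) 1 j) ρ''
          simp only [Function.update_self, Function.update_of_ne zero_ne_one] at h1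
          rw [h1.1, h1.2]
          refine ⟨h''.1.step i j, fun u v huv => ?_⟩
          by_cases h2 : u = i ∧ v = j
          · rw [h2.1, h2.2]
            exact not_onMixedCycle_self_step i j
          · refine not_onMixedCycle_step (h''.2 u v ?_) i j
            rw [Fin.ext_iff, Fin.ext_iff] at h2
            rw [Fin.ext_iff] at huv ⊢
            omega)
      refine ⟨inner.1, fun u v hu => inner.2 u v ?_⟩
      rw [Fin.ext_iff]
      omega
  exact ⟨key.1, fun u v => key.2 u v u.2⟩

/-- The number of the relation that holds the implications from literals of sign `b` to literals of
sign `c`. -/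
def implIx : Bool → Bool → ℕ
  | false, false => 8
  | false, true => 9
  | true, false => 10
  | true, true => 11

/-- The number of the relation `Linked` for the values `b` and `c`. -/
def linkIx : Bool → Bool → ℕ
  | false, false => 13
  | false, true => 14
  | true, false => 15
  | true, true => 16

/-- Execute a statement for all pairs of truth values. -/
def forBool (S : Bool → Bool → Stmt) : Stmt :=
  seq (seq (S false false) (S false true)) (seq (S true false) (S true true))

/-- Computes the fixed arcs, the reachability along them, and the free edges. -/
def fixStmt : Stmt :=
  seq (assign 12 (and (rel 0 0 1) (and (rel 6 0 1) (not (rel 6 1 0)))))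
  (seq (assign 4 (or (or (rel 12 0 1) (rel 1 0 1)) (eq 0 1)))
  (seq (warshall 4 0)
  (assign 7 (and (not (rel 5 0 0)) (and (rel 5 1 1) (and (rel 0 0 1)
    (and (not (rel 12 0 1)) (not (rel 12 1 0)))))))))

/-- Defines `Linked` for the values `b` and `c`. -/
def linkFormula (b c : Bool) : Formula :=
  ex (ex (and (or (eq 2 0) (if b then rel 7 0 2 else fls))
    (and (or (eq 3 1) (if c then fls else rel 7 1 3)) (rel 4 2 3))))

/-- Defines the implications from literals of sign `b` to literals of sign `c`. -/
def implFormula (b c : Bool) : Formula :=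
  or (and (rel 2 0 1) (not (rel (linkIx b !c) 0 1)))
    (and (rel 2 1 0) (not (rel (linkIx (!c) b) 1 0)))

/-- Warshall's algorithm for the implications: the step for the literal whose variable is the vertex
variable `0` and whose sign is `p`. -/
def pivotStmt (p : Bool) : Stmt :=
  forBool fun b c => assign (implIx b c)
    (or (rel (implIx b c) 1 2) (and (rel (implIx b p) 1 0) (rel (implIx p c) 0 2)))

/-- Computes the transitive closure of the implications that belong to the relations `5` and `6`. -/
def verify : Stmt :=
  seq fixStmt
  (seq (forBool fun b c => assign (linkIx b c) (linkFormula b c))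
  (seq (forBool fun b c => assign (implIx b c) (implFormula b c))
  (forEach (seq (pivotStmt false) (pivotStmt true)))))

theorem fixStmt_run (e : ℕ → Fin n) (ρ : Rels n) :
    (∀ u v, fixStmt.run 0 e ρ 4 u v ↔ Joins (fixedArcs (ρ 0) (ρ 6)) (ρ 1) u v) ∧
    ∀ u v, fixStmt.run 0 e ρ 7 u v ↔ freeEdge (ρ 0) (ρ 6) (fun w => ρ 5 w w) u v := by
  simp only [fixStmt, run]
  set ρ₁ : Rels n := Function.update ρ 12 _ with hρ₁
  set ρ₂ : Rels n := Function.update ρ₁ 4 _ with hρ₂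
  have h12 : ∀ u v, ρ₁ 12 u v ↔ fixedArcs (ρ 0) (ρ 6) u v := fun u v => by
    simp [hρ₁, Sat, fixedArcs]
  have h1 : ∀ a, a ≠ 12 → ρ₁ a = ρ a := fun a ha => by rw [hρ₁, Function.update_of_ne ha]
  have h2 : ∀ a, a ≠ 4 → (warshall 4 0).run 0 e ρ₂ a = ρ₁ a := fun a ha => by
    rw [warshall_run_of_ne _ _ _ ha, hρ₂, Function.update_of_ne ha]
  constructor
  · intro u v
    rw [Function.update_of_ne (by decide), warshall_run, Joins]
    refine transGen_or_eq_iff (fun a b => ?_) u v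
    simp [hρ₂, Sat, h12, h1]
  · intro u v
    simp [Sat, h2, h12, h1, freeEdge]

theorem forBool_assign_run {d : ℕ} {e : ℕ → Fin n} {ρ : Rels n} {ix : Bool → Bool → ℕ}
    (hix : ∀ {b c b' c'}, ix b c = ix b' c' → b = b' ∧ c = c') (φ : Bool → Bool → Formula)
    (hφ : ∀ b c (ρ' : Rels n) e, (∀ a, (∀ b c, a ≠ ix b c) → ρ' a = ρ a) →
      ((φ b c).Sat ρ' (d + 2) e ↔ (φ b c).Sat ρ (d + 2) e)) (b c : Bool) (u v : Fin n) :
    (forBool fun b c => assign (ix b c) (φ b c)).run d e ρ (ix b c) u v ↔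
      (φ b c).Sat ρ (d + 2) (Function.update (Function.update e d u) (d + 1) v) := by
  have hiff : ∀ b c b' c', ix b c = ix b' c' ↔ b = b' ∧ c = c' := fun b c b' c' =>
    ⟨hix, fun h => by rw [h.1, h.2]⟩
  simp only [forBool, run]
  rcases b with _ | _ <;> rcases c with _ | _ <;> simp only [Function.update_apply, hiff]
  all_goals simp
  all_goals
    apply hφ
    intro a ha
    simp [Function.update_of_ne, ha]

theorem implIx_inj {b c b' c' : Bool} (h : implIx b c = implIx b' c') : b = b' ∧ c = c' := by
  revert b c b' c'
  decide

theorem linkIx_inj {b c b' c' : Bool} (h : linkIx b c = linkIx b' c') : b = b' ∧ c = c' := by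
  revert b c b' c'
  decide

/-- Updating the four relations one after the other is as good as updating them simultaneously,
since the row and the column of the pivot do not change. -/
theorem pivotStmt_run (p : Bool) (e : ℕ → Fin n) (ρ : Rels n) (b c : Bool) (u v : Fin n) :
    (pivotStmt p).run 1 e ρ (implIx b c) u v ↔
      ρ (implIx b c) u v ∨ ρ (implIx b p) u (e 0) ∧ ρ (implIx p c) (e 0) v := by
  cases p <;> cases b <;> cases c <;>
    simp [pivotStmt, forBool, run, Sat, implIx] <;> tauto

theorem verify_run (e : ℕ → Fin n) (ρ : Rels n) (b c : Bool) (u v : Fin n) :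
    verify.run 0 e ρ (implIx b c) u v ↔
      TransGen (Implies (ρ 2) (Linked (ρ 0) (ρ 1) (ρ 6) fun w => ρ 5 w w)) (u, b) (v, c) := by
  simp only [verify, run]
  set ρ₁ := fixStmt.run 0 e ρ with hρ₁
  set ρ₂ := (forBool fun b c => assign (linkIx b c) (linkFormula b c)).run 0 e ρ₁ with hρ₂
  set ρ₃ := (forBool fun b c => assign (implIx b c) (implFormula b c)).run 0 e ρ₂ with hρ₃
  obtain ⟨h4, h7⟩ := fixStmt_run e ρ
  rw [← hρ₁] at h4 h7
  have hlink : ∀ b c u v, ρ₂ (linkIx b c) u v ↔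
      Linked (ρ 0) (ρ 1) (ρ 6) (fun w => ρ 5 w w) u v b c := by
    intro b c u v
    rw [hρ₂, forBool_assign_run linkIx_inj]
    · cases b <;> cases c <;>
        simp [linkFormula, Sat, Linked, h4, h7]
    · intro b c ρ' e' h
      have h4' := h 4 (by decide)
      have h7' := h 7 (by decide)
      cases b <;> cases c <;> simp [linkFormula, Sat, h4', h7']
  have h2 : ρ₂ 2 = ρ 2 := by
    rw [hρ₂, run_of_not_writes _ (by simp [forBool, Writes, linkIx]), hρ₁,
      run_of_not_writes _ (by simp [fixStmt, warshall, Writes])]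
  have himpl : ∀ b c u v, ρ₃ (implIx b c) u v ↔
      Implies (ρ 2) (Linked (ρ 0) (ρ 1) (ρ 6) fun w => ρ 5 w w) (u, b) (v, c) := by
    intro b c u v
    rw [hρ₃, forBool_assign_run implIx_inj]
    · simp [implFormula, Sat, Implies, hlink, h2]
    · intro b c ρ' e' h
      have h2' := h 2 (by decide)
      have hl : ∀ b c, ρ' (linkIx b c) = ρ₂ (linkIx b c) := fun b c => h _ (by
        revert b c
        decide)
      simp [implFormula, Sat, h2', hl]
  have key := foldl_finRange_induction
    (fun (ρ' : Rels n) w => (pivotStmt true).run 1 (Function.update e 0 w)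
      ((pivotStmt false).run 1 (Function.update e 0 w) ρ')) ρ₃
    (fun i ρ' => WarshallInv (Implies (ρ 2) (Linked (ρ 0) (ρ 1) (ρ 6) fun w => ρ 5 w w))
      (fun l => (l.1 : ℕ) < i) fun l m => ρ' (implIx l.2 m.2) l.1 m.1) ?_ ?_
  · exact key.iff_transGen (fun l => l.1.2) (u, b) (v, c)
  · exact ⟨fun l m h => (himpl _ _ _ _).2 h, fun l m h => .single ((himpl _ _ _ _).1 h),
      fun w hw => absurd hw (Nat.not_lt_zero _)⟩
  · intro i ρ' h
    refine (h.step (W' := fun l => (l.1 : ℕ) < i ∨ l = (i, false)) (i, false)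
      (S' := fun l m => (pivotStmt false).run 1 (Function.update e 0 i) ρ' (implIx l.2 m.2) l.1 m.1)
      (fun x y => ?_) fun z => id).step (i, true) (fun x y => ?_) fun z hz => ?_
    · rw [pivotStmt_run]
      simp
    · rw [pivotStmt_run]
      simp
    · obtain ⟨z, b⟩ := z
      have : (z : ℕ) < i ∨ z = i := by
        rw [Fin.ext_iff]
        simp only at hz
        omega
      cases b <;> simpa using this

/-- No variable is equivalent to its negation. -/
def acceptFormula : Formula :=
  not (ex (and (rel (implIx false true) 0 0) (rel (implIx true false) 0 0)))

theorem acceptFormula_sat (e e' : ℕ → Fin n) (ρ : Rels n) :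
    acceptFormula.Sat (verify.run 0 e ρ) 0 e' ↔ ∃ β : Fin n → Bool, ∀ s t, ρ 2 s t →
      Linked (ρ 0) (ρ 1) (ρ 6) (fun w => ρ 5 w w) s t (β s) (β t) := by
  rw [exists_forall_iff_transGen]
  simp [acceptFormula, Sat, verify_run]

/-- The relation `5` describes a vertex cover. -/
def coverFormula : Formula :=
  not (ex (ex (and (or (rel 0 0 1) (rel 1 0 1)) (and (not (rel 5 0 0)) (not (rel 5 1 1))))))

theorem verify_run_of_le {a : ℕ} (h : a = 0 ∨ a = 1 ∨ a = 2 ∨ a = 5 ∨ a = 6) (e : ℕ → Fin n)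
    (ρ : Rels n) : verify.run 0 e ρ a = ρ a := by
  refine run_of_not_writes _ ?_
  rcases h with rfl | rfl | rfl | rfl | rfl <;>
    simp [verify, fixStmt, warshall, forBool, pivotStmt, Writes, linkIx, implIx]

theorem coverFormula_sat (e e' : ℕ → Fin n) (ρ : Rels n) :
    coverFormula.Sat (verify.run 0 e ρ) 0 e' ↔ ∀ u v, ρ 0 u v ∨ ρ 1 u v → ρ 5 u u ∨ ρ 5 v v := by
  have h0 := verify_run_of_le (a := 0) (by decide) e ρ
  have h1 := verify_run_of_le (a := 1) (by decide) e ρ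
  have h5 := verify_run_of_le (a := 5) (by decide) e ρ
  simp [coverFormula, Sat, h0, h1, h5]
  grind

theorem preprocess_wf : preprocess.Wf 0 := by
  simp [preprocess, orientStmt, samePair, warshall, Stmt.Wf, Formula.Wf]

theorem verify_wf : verify.Wf 0 := by
  simp [verify, fixStmt, warshall, forBool, linkFormula, implFormula, pivotStmt, Stmt.Wf,
    Formula.Wf, linkIx, implIx]

theorem acceptFormula_wf : acceptFormula.Wf 0 := by
  simp [acceptFormula, Formula.Wf, implIx]

theorem coverFormula_wf : coverFormula.Wf 0 := by
  simp [coverFormula, Formula.Wf]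

/-! ### Reading certificates

A certificate is a number `c`. Its first `k` digits to the base `n` are the vertices of a candidate
cover, and the following `2 m` digits are the endpoints of `m` arcs. The registers from `10` to `19`
belong to the enumeration: `10` holds `k`, `11` holds `m`, `12` holds `c`, `13` the part of `c` that
has not been read, `14` and `15` control the loops over `c` and `k`, `16` is a counter, and `17` to
`19` are auxiliary. -/

/-- The candidate cover, on the diagonal, that is encoded in the first `k` digits of `c`. -/
def certCover (n k c : ℕ) : Fin n → Fin n → Prop :=
  fun u v => u = v ∧ ∃ j < k, c / n ^ j % n = u

/-- The `m` arcs that are encoded in the digits of `c` from the `k`-th on. -/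
def certArcs (n k m c : ℕ) : Fin n → Fin n → Prop :=
  fun u v => ∃ j < m, c / n ^ (k + 2 * j) % n = u ∧ c / n ^ (k + 2 * j + 1) % n = v

theorem certCover_zero (n c : ℕ) : certCover n 0 c = fun _ _ => False := by
  ext
  simp [certCover]

theorem certArcs_zero (n k c : ℕ) : certArcs n k 0 c = fun _ _ => False := by
  ext
  simp [certArcs]

theorem exists_digits {n : ℕ} (M : ℕ) (h : ℕ → ℕ) (hn : ∀ j, h j < n) :
    ∃ c < n ^ M, ∀ j < M, c / n ^ j % n = h j := by
  induction M generalizing h with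
  | zero => exact ⟨0, by simp, by simp⟩
  | succ M ih =>
    obtain ⟨c, hc, hc'⟩ := ih (fun j => h (j + 1)) fun j => hn (j + 1)
    have h0 := hn 0
    refine ⟨h 0 + n * c, ?_, fun j hj => ?_⟩
    · calc h 0 + n * c < n * (c + 1) := by rw [mul_add]; omega
        _ ≤ n * n ^ M := Nat.mul_le_mul_left n hc
        _ = n ^ (M + 1) := by ring
    · rcases j with _ | j
      · simp [Nat.mod_eq_of_lt h0]
      · rw [pow_succ', ← Nat.div_div_eq_div_mul, Nat.add_mul_div_left _ _ (by omega),
          Nat.div_eq_of_lt h0, zero_add]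
        exact hc' j (by omega)

/-- Every choice of `k` vertices and `m` pairs is encoded by a certificate. -/
theorem exists_certificate {n k m : ℕ} (hn : 0 < n) (x : Fin k → Fin n)
    (g : Fin m → Fin n × Fin n) :
    ∃ c < n ^ (k + 2 * m), (certCover n k c = fun u v => u = v ∧ ∃ i, x i = u) ∧
      certArcs n k m c = fun u v => ∃ i, g i = (u, v) := by
  let h : ℕ → ℕ := fun j =>
    if h1 : j < k then x ⟨j, h1⟩
    else if h2 : (j - k) / 2 < m then
      if (j - k) % 2 = 0 then (g ⟨(j - k) / 2, h2⟩).1 else (g ⟨(j - k) / 2, h2⟩).2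
    else 0
  obtain ⟨c, hc, hdig⟩ := exists_digits (n := n) (k + 2 * m) h (by
    intro j
    simp only [h]
    split_ifs
    exacts [Fin.is_lt _, Fin.is_lt _, Fin.is_lt _, hn])
  have hX : ∀ j : Fin k, c / n ^ (j : ℕ) % n = x j := fun j => by
    rw [hdig j (by omega)]
    simp [h]
  have hL₁ : ∀ j : Fin m, c / n ^ (k + 2 * (j : ℕ)) % n = (g j).1 := fun j => by
    rw [hdig _ (by omega)]
    simp [h]
  have hL₂ : ∀ j : Fin m, c / n ^ (k + 2 * (j : ℕ) + 1) % n = (g j).2 := fun j => by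
    have h1 : (k + 2 * (j : ℕ) + 1 - k) / 2 = j := by omega
    have h2 : (k + 2 * (j : ℕ) + 1 - k) % 2 = 1 := by omega
    have h3 : ¬ k + 2 * (j : ℕ) + 1 < k := by omega
    rw [hdig _ (by omega)]
    simp [h, h1, h2, h3]
  refine ⟨c, hc, ?_, ?_⟩
  · ext u v
    refine and_congr_right fun _ => ⟨?_, ?_⟩
    · rintro ⟨j, hj, h1⟩
      exact ⟨⟨j, hj⟩, Fin.ext ((hX ⟨j, hj⟩).symm.trans h1)⟩
    · rintro ⟨i, rfl⟩
      exact ⟨i, i.2, hX i⟩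
  · ext u v
    constructor
    · rintro ⟨j, hj, h1, h2⟩
      exact ⟨⟨j, hj⟩, Prod.ext (Fin.ext ((hL₁ ⟨j, hj⟩).symm.trans h1))
        (Fin.ext ((hL₂ ⟨j, hj⟩).symm.trans h2))⟩
    · rintro ⟨i, hi⟩
      exact ⟨i, i.2, by rw [hL₁, hi], by rw [hL₂, hi]⟩

/-- Divides register `13` by `n`; the remainder goes to register `r`. -/
def divProg (r : ℕ) : Program :=
  radd r 13 2 ;; rconst 13 0 ;; radd 19 r 3 ;; rsub 19 19 1 ;;
  Program.loop 19 (rsub r r 1 ;; radd 13 13 3 ;; radd 19 r 3 ;; rsub 19 19 1)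

theorem divProg_exec {n r : ℕ} {s : State} (hs : Base n s) (hn : 0 < n) (hr : r = 17 ∨ r = 18) :
    Exec (divProg r) s (5 * s.reg 13 + 5) fun s' => s'.mem = s.mem ∧
      s'.reg r = s.reg 13 % n ∧ s'.reg 13 = s.reg 13 / n ∧
      ∀ i, i ≠ r → i ≠ 13 → i ≠ 19 → s'.reg i = s.reg i := by
  obtain ⟨h1, h2, h3⟩ := hs
  set q := s.reg 13 with hq
  have hdm := Nat.mod_add_div q n
  have hlt := Nat.mod_lt q hn
  refine Exec.mono (T := 1 + (1 + (1 + (1 + (q / n * ((1 + (1 + (1 + 1))) + 1) + 1))))) ?_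
    (by have := Nat.div_le_self q n; omega) fun _ h => h
  refine .seq (.instr (.seq (.instr (.seq (.instr (.seq (.instr ?_)))))))
  refine (Exec.loop (fun k s' => s'.mem = s.mem ∧ s'.reg r = q % n + k * n ∧ s'.reg 13 + k = q / n ∧
    s'.reg 19 = s'.reg r + 1 - n ∧ ∀ i, i ≠ r → i ≠ 13 → i ≠ 19 → s'.reg i = s.reg i) (q / n) ?_
    (fun s' h => ?_) ?_).imp fun s' h => ⟨h.1, by simpa using h.2.1, h.2.2.1, h.2.2.2.2⟩
  · refine ⟨rfl, ?_, ?_, ?_, fun i hi1 hi2 hi3 => ?_⟩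
    · simp (disch := omega) [Instr.apply, Function.update_of_ne, h2]
      rw [mul_comm (q / n), hdm]
    · simp (disch := omega) [Instr.apply, Function.update_of_ne]
    · simp (disch := omega) [Instr.apply, Function.update_of_ne, h1, h2, h3]
    · simp (disch := omega) [Instr.apply, Function.update_of_ne]
  · rw [h.2.2.2.1, h.2.1]
    omega
  · rintro k s' - ⟨g1, g2, g3, g4, g5⟩
    have e1 := (g5 1 (by omega) (by omega) (by omega)).trans h1
    have e3 := (g5 3 (by omega) (by omega) (by omega)).trans h3
    have hmul : (k + 1) * n = k * n + n := by ring
    refine ⟨by omega, .seq (.instr (.seq (.instr (.seq (.instr (.instr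
      ⟨g1, ?_, ?_, ?_, fun i hi1 hi2 hi3 => ?_⟩))))))⟩
    · simp (disch := omega) [Instr.apply, Function.update_of_ne, e1, g2]
      omega
    · simp (disch := omega) [Instr.apply, Function.update_of_ne, e3]
      omega
    · simp (disch := omega) [Instr.apply, Function.update_of_ne, e1, e3]
    · rw [← g5 i hi1 hi2 hi3]
      simp (disch := omega) [Instr.apply, Function.update_of_ne]

/-- Inserts the pair that is given by the registers `i` and `j` into the relation `a`. -/
def markProg (a i j : ℕ) : Program := addrProg a i j ;; rstore 5 3

theorem markProg_exec {a i j : ℕ} {s : State} {ρ : Rels n} {u v : Fin n} (hs : Base n s)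
    (hi : 10 ≤ i) (hu : s.reg i = u) (hv : s.reg j = v) (hm : Holds ρ s.mem) :
    Exec (markProg a i j) s (addrCost a n + 1) fun s' =>
      (∀ r, (r < 4 ∨ 10 ≤ r) → s'.reg r = s.reg r) ∧
      Holds (Function.update ρ a fun x y => ρ a x y ∨ (x = u ∧ y = v)) s'.mem := by
  refine (addrProg_exec hs hi (by rw [hu]; exact u.2)).seq_of ?_
  rintro s' ⟨g1, g2, g3⟩
  have h3 : s'.reg 3 = 1 := (g3 3 (by omega)).trans hs.one
  refine .instr ⟨fun r hr => g3 r (by omega), fun b hb x y => ?_⟩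
  simp only [Instr.apply]
  rw [g2, hu, hv, h3, g1]
  by_cases h : b = a ∧ x = u ∧ y = v
  · obtain ⟨rfl, rfl, rfl⟩ := h
    simp
  · rw [Function.update_of_ne, hm b hb]
    · by_cases hba : b = a
      · subst hba
        simp only [Function.update_self]
        tauto
      · rw [Function.update_of_ne hba]
    · rw [ne_eq, addr_inj x.2 u.2 y.2 v.2, ← Fin.ext_iff, ← Fin.ext_iff]
      exact h

/-- The memory holds the edges `E`, the arcs `A`, the terminal pairs `T`, the candidate cover `X`
and the certificate `L`. -/
def Stored (E A T X L : Fin n → Fin n → Prop) (m : ℕ → ℕ) : Prop :=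
  ∃ ρ : Rels n, Holds ρ m ∧ ρ 0 = E ∧ ρ 1 = A ∧ ρ 2 = T ∧ ρ 5 = X ∧ ρ 6 = L

/-- The registers that hold the state of the enumeration have the same contents. -/
def KeepMain (s s' : State) : Prop :=
  ∀ r, (r < 4 ∨ r = 10 ∨ r = 11 ∨ r = 12 ∨ r = 14 ∨ r = 15) → s'.reg r = s.reg r

theorem KeepMain.trans {s s' s'' : State} (h : KeepMain s s') (h' : KeepMain s' s'') :
    KeepMain s s'' :=
  fun r hr => (h' r hr).trans (h r hr)

theorem KeepMain.base {s s' : State} (h : KeepMain s s') (hs : Base n s) : Base n s' :=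
  ⟨(h 1 (by omega)).trans hs.1, (h 2 (by omega)).trans hs.2, (h 3 (by omega)).trans hs.3⟩

theorem Keep.keepMain {d : ℕ} {s s' : State} (h : Keep d s s') : KeepMain s s' :=
  fun r hr => h r (by omega) (by omega)

/-- Moves the first `k` digits into the candidate cover. -/
def readCover : Program :=
  radd 16 10 2 ;; Program.loop 16 (divProg 17 ;; markProg 5 17 17 ;; rsub 16 16 3)

/-- Moves the next `2 m` digits into the set of arcs. -/
def readArcs : Program :=
  radd 16 11 2 ;;
  Program.loop 16 (divProg 17 ;; divProg 18 ;; markProg 6 17 18 ;; rsub 16 16 3)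

variable {E A T X L : Fin n → Fin n → Prop}

theorem readCover_exec {s : State} {k c : ℕ} (hs : Base n s) (hn : 0 < n) (hk : s.reg 10 = k)
    (hc : s.reg 13 = c) (hm : Stored E A T (fun _ _ => False) L s.mem) :
    Exec readCover s (k * (5 * c + addrCost 5 n + 8) + 2) fun s' => KeepMain s s' ∧
      s'.reg 13 = c / n ^ k ∧ Stored E A T (certCover n k c) L s'.mem := by
  refine Exec.mono (T := 1 + (k * ((5 * c + 5) + ((addrCost 5 n + 1) + 1) + 1) + 1)) ?_
    (by ring_nf; omega) fun _ h => h
  refine .seq (.instr ((Exec.loop (fun j s' => j ≤ k ∧ KeepMain s s' ∧ s'.reg 16 = j ∧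
    s'.reg 13 = c / n ^ (k - j) ∧ Stored E A T (certCover n (k - j) c) L s'.mem) k ?_
    (fun s' h => h.2.2.1) ?_).imp fun s' h => ⟨h.2.1, by simpa using h.2.2.2⟩))
  · refine ⟨le_rfl, fun r hr => ?_, ?_, ?_, ?_⟩
    · simp (disch := omega) [Instr.apply, Function.update_of_ne]
    · simp [Instr.apply, hk, hs.zero]
    · simp (disch := omega) [Instr.apply, Function.update_of_ne, hc]
    · simpa [Instr.apply, certCover_zero] using hm
  · rintro j s' hj ⟨-, g1, g2, g3, ρ, g4, g5, g6, g7, g8, g9⟩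
    have hb := g1.base hs
    set i := k - (j + 1) with hi
    have hi' : k - j = i + 1 := by omega
    have hci : c / n ^ i ≤ c := Nat.div_le_self _ _
    refine ⟨by omega, ((divProg_exec hb hn (Or.inl rfl)).mono (by omega) fun _ h => h).seq_of ?_⟩
    rintro s₁ ⟨k1, k2, k3, k4⟩
    have hk₁ : KeepMain s s₁ :=
      g1.trans fun r hr => k4 r (by omega) (by omega) (by omega)
    have hu : s₁.reg 17 = (⟨c / n ^ i % n, Nat.mod_lt _ hn⟩ : Fin n) := by rw [k2, g3]
    refine (markProg_exec (hk₁.base hs) (by omega) hu hu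
      (k1 ▸ g4)).seq_of ?_
    rintro s₂ ⟨l1, l2⟩
    have hk₂ : KeepMain s s₂ := hk₁.trans fun r hr => l1 r (by omega)
    have h16 : s₂.reg 16 = j + 1 := by
      rw [l1 16 (by omega), k4 16 (by omega) (by omega) (by omega), g2]
    refine .instr ⟨by omega, fun r hr => ?_, ?_, ?_, _, l2, ?_⟩
    · rw [← hk₂ r hr]
      simp (disch := omega) [Instr.apply, Function.update_of_ne]
    · simp [Instr.apply, h16, (hk₂.base hs).one]
    · simp (disch := omega) only [Instr.apply, Function.update_of_ne]
      rw [l1 13 (by omega), k3, g3, Nat.div_div_eq_div_mul, hi', pow_succ]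
    · refine ⟨by simp [g5], by simp [g6], by simp [g7], ?_, by simp [g9]⟩
      rw [Function.update_self, hi', g8]
      ext x y
      simp only [certCover, Nat.lt_succ_iff_lt_or_eq, Fin.ext_iff]
      constructor
      · rintro (⟨h1, l, h2, h3⟩ | ⟨h1, h2⟩)
        · exact ⟨h1, l, Or.inl h2, h3⟩
        · exact ⟨h1.trans h2.symm, i, Or.inr rfl, h1.symm⟩
      · rintro ⟨h1, l, h2 | rfl, h3⟩
        · exact Or.inl ⟨h1, l, h2, h3⟩
        · exact Or.inr ⟨h3.symm, h1 ▸ h3.symm⟩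

theorem readArcs_exec {s : State} {k m c : ℕ} (hs : Base n s) (hn : 0 < n) (hm' : s.reg 11 = m)
    (hc : s.reg 13 = c / n ^ k) (hm : Stored E A T X (fun _ _ => False) s.mem) :
    Exec readArcs s (m * (10 * c + addrCost 6 n + 13) + 2) fun s' => KeepMain s s' ∧
      s'.reg 13 = c / n ^ (k + 2 * m) ∧ Stored E A T X (certArcs n k m c) s'.mem := by
  refine Exec.mono (T := 1 + (m * ((5 * c + 5) + ((5 * c + 5) + ((addrCost 6 n + 1) + 1)) + 1) + 1))
    ?_ (by ring_nf; omega) fun _ h => h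
  refine .seq (.instr ((Exec.loop (fun j s' => j ≤ m ∧ KeepMain s s' ∧ s'.reg 16 = j ∧
    s'.reg 13 = c / n ^ (k + 2 * (m - j)) ∧ Stored E A T X (certArcs n k (m - j) c) s'.mem) m ?_
    (fun s' h => h.2.2.1) ?_).imp fun s' h => ⟨h.2.1, by simpa using h.2.2.2⟩))
  · refine ⟨le_rfl, fun r hr => ?_, ?_, ?_, ?_⟩
    · simp (disch := omega) [Instr.apply, Function.update_of_ne]
    · simp [Instr.apply, hm', hs.zero]
    · simp (disch := omega) [Instr.apply, Function.update_of_ne, hc]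
    · simpa [Instr.apply, certArcs_zero] using hm
  · rintro j s' hj ⟨-, g1, g2, g3, ρ, g4, g5, g6, g7, g8, g9⟩
    have hb := g1.base hs
    set i := m - (j + 1) with hi
    have hi' : m - j = i + 1 := by omega
    have hci : ∀ i, c / n ^ i ≤ c := fun i => Nat.div_le_self _ _
    refine ⟨by omega, ((divProg_exec hb hn (Or.inl rfl)).mono
      (by have := hci (k + 2 * i); omega) fun _ h => h).seq_of ?_⟩
    rintro s₁ ⟨k1, k2, k3, k4⟩
    have hk₁ : KeepMain s s₁ :=
      g1.trans fun r hr => k4 r (by omega) (by omega) (by omega)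
    have h13 : s₁.reg 13 = c / n ^ (k + 2 * i + 1) := by
      rw [k3, g3, Nat.div_div_eq_div_mul, pow_succ]
    refine ((divProg_exec (hk₁.base hs) hn (Or.inr rfl)).mono
      (by have := hci (k + 2 * i + 1); omega) fun _ h => h).seq_of ?_
    rintro s₂ ⟨l1, l2, l3, l4⟩
    have hk₂ : KeepMain s s₂ :=
      hk₁.trans fun r hr => l4 r (by omega) (by omega) (by omega)
    have hu : s₂.reg 17 = (⟨c / n ^ (k + 2 * i) % n, Nat.mod_lt _ hn⟩ : Fin n) := by
      rw [l4 17 (by omega) (by omega) (by omega), k2, g3]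
    have hv : s₂.reg 18 = (⟨c / n ^ (k + 2 * i + 1) % n, Nat.mod_lt _ hn⟩ : Fin n) := by
      rw [l2, h13]
    refine (markProg_exec (hk₂.base hs) (by omega) hu hv
      (by rw [l1, k1]; exact g4)).seq_of ?_
    rintro s₃ ⟨q1, q2⟩
    have hk₃ : KeepMain s s₃ := hk₂.trans fun r hr => q1 r (by omega)
    have h16 : s₃.reg 16 = j + 1 := by
      rw [q1 16 (by omega), l4 16 (by omega) (by omega) (by omega),
        k4 16 (by omega) (by omega) (by omega), g2]
    refine .instr ⟨by omega, fun r hr => ?_, ?_, ?_, _, q2, ?_⟩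
    · rw [← hk₃ r hr]
      simp (disch := omega) [Instr.apply, Function.update_of_ne]
    · simp [Instr.apply, h16, (hk₃.base hs).one]
    · simp (disch := omega) only [Instr.apply, Function.update_of_ne]
      rw [q1 13 (by omega), l3, h13, Nat.div_div_eq_div_mul, ← pow_succ, hi']
      rfl
    · refine ⟨by simp [g5], by simp [g6], by simp [g7], by simp [g8], ?_⟩
      rw [Function.update_self, hi', g9]
      ext x y
      simp only [certArcs, Nat.lt_succ_iff_lt_or_eq, Fin.ext_iff]
      constructor
      · rintro (⟨l, h1, h2⟩ | ⟨h1, h2⟩)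
        · exact ⟨l, Or.inl h1, h2⟩
        · exact ⟨i, Or.inr rfl, h1.symm, h2.symm⟩
      · rintro ⟨l, h1 | rfl, h2, h3⟩
        · exact Or.inl ⟨l, h1, h2, h3⟩
        · exact Or.inr ⟨h2.symm, h3.symm⟩

/-- Empties the candidate cover and the set of arcs. -/
def clearStmt : Stmt := .seq (.assign 5 .fls) (.assign 6 .fls)

/-- Decodes the certificate in register `12`. -/
def decodeProg : Program :=
  clearStmt.compile 0 ;; radd 13 12 2 ;; readCover ;; readArcs

theorem decodeProg_exec {s : State} {k m c : ℕ} (hs : Base n s) (hn : 0 < n) (hk : s.reg 10 = k)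
    (hm' : s.reg 11 = m) (hc : s.reg 12 = c) (hm : Stored E A T X L s.mem) :
    Exec decodeProg s (clearStmt.cost n +
      (1 + ((k * (5 * c + addrCost 5 n + 8) + 2) + (m * (10 * c + addrCost 6 n + 13) + 2))))
      fun s' => KeepMain s s' ∧ s'.reg 13 = c / n ^ (k + 2 * m) ∧
        Stored E A T (certCover n k c) (certArcs n k m c) s'.mem := by
  obtain ⟨ρ, h, h0, h1, h2, h5, h6⟩ := hm
  refine (clearStmt.compile_exec (e := fun _ => ⟨0, hn⟩) (ρ := ρ) (d := 0)
    (by simp [clearStmt, Stmt.Wf, Formula.Wf]) hs (fun i hi => absurd hi (Nat.not_lt_zero i))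
    h).seq_of ?_
  rintro s₁ ⟨g1, g2⟩
  have hk₁ := g1.keepMain
  refine .seq (.instr ?_)
  set s₂ := (Instr.add 13 12 2).apply s₁ with hs₂
  have hk₂ : KeepMain s s₂ := hk₁.trans fun r hr => by
    simp (disch := omega) [hs₂, Instr.apply, Function.update_of_ne]
  have h13 : s₂.reg 13 = c := by
    simp [hs₂, Instr.apply, hk₁ 12 (by omega), hc, (hk₁.base hs).zero]
  refine (readCover_exec (hk₂.base hs) hn ((hk₂ 10 (by omega)).trans hk) h13 (E := E) (A := A)
    (T := T) (L := fun _ _ => False) ⟨_, g2, ?_⟩).seq_of ?_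
  · simp [clearStmt, Stmt.run, Formula.Sat, h0, h1, h2]
  · rintro s₃ ⟨k1, k2, k3⟩
    have hk₃ := hk₂.trans k1
    exact (readArcs_exec (hk₃.base hs) hn ((hk₃ 11 (by omega)).trans hm') k2 k3).imp
      fun s₄ h => ⟨hk₃.trans h.1, h.2⟩

/-! ### The enumeration of the certificates -/

/-- The test that a certificate has to pass. -/
def Accepts (E A T X L : Fin n → Fin n → Prop) : Prop :=
  ∃ β : Fin n → Bool, ∀ s t, T s t → Linked E A L (fun w => X w w) s t (β s) (β t)

/-- The diagonal of `X` is a vertex cover. -/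
def Covers (E A X : Fin n → Fin n → Prop) : Prop :=
  ∀ u v, E u v ∨ A u v → X u u ∨ X v v

/-- Tests a decoded certificate. If it passes the test, the answer `1` is recorded in register `0`.
If its vertices form a cover, register `15` is cleared, so that no larger covers are tried. -/
def testProg : Program :=
  verify.compile 0 ;; acceptFormula.compile 0 ;; Program.ite 4 (rconst 0 1) .skip ;;
  coverFormula.compile 0 ;; Program.ite 4 (rconst 15 0) .skip ;; radd 12 12 3

/-- A bound for the number of steps of `testProg`. -/
def testCost (n : ℕ) : ℕ :=
  verify.cost n + (acceptFormula.cost n + (3 + (coverFormula.cost n + (3 + 1))))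

theorem ite_const_skip_exec {s : State} {i c : ℕ} {Q : State → Prop}
    (h : s.reg 4 ≠ 0 → Q ((Instr.const i c).apply s)) (h' : s.reg 4 = 0 → Q s) :
    Exec (.ite 4 (rconst i c) .skip) s 3 Q :=
  Exec.ite (T := 1) (T' := 1) (fun h0 => .instr (h h0)) fun h0 => .skip (h' h0)

theorem testProg_exec {s : State} {P Q : Prop} (hs : Base n s) (hn : 0 < n)
    (h0 : s.reg 0 = bit P) (h15 : s.reg 15 = bit Q) (hm : Stored E A T X L s.mem) :
    Exec testProg s (testCost n) fun s' => Base n s' ∧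
      (∀ r, r = 10 ∨ r = 11 ∨ r = 14 → s'.reg r = s.reg r) ∧ s'.reg 12 = s.reg 12 + 1 ∧
      s'.reg 0 = bit (P ∨ Accepts E A T X L) ∧ s'.reg 15 = bit (Q ∧ ¬ Covers E A X) ∧
      Stored E A T X L s'.mem := by
  obtain ⟨ρ, h, hρ⟩ := hm
  obtain ⟨hE, hA, hT, hX, hL⟩ := hρ
  let e : ℕ → Fin n := fun _ => ⟨0, hn⟩
  have hv : ∀ s, Vars 0 e s := fun s i hi => absurd hi (Nat.not_lt_zero i)
  have hacc : acceptFormula.Sat (verify.run 0 e ρ) 0 e ↔ Accepts E A T X L := by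
    rw [acceptFormula_sat, hE, hA, hT, hX, hL, Accepts]
  have hcov : coverFormula.Sat (verify.run 0 e ρ) 0 e ↔ Covers E A X := by
    rw [coverFormula_sat, hE, hA, hX, Covers]
  have hst : ∀ m, Holds (verify.run 0 e ρ) m → Stored E A T X L m := fun m hm =>
    ⟨_, hm, (verify_run_of_le (by decide) e ρ).trans hE, (verify_run_of_le (by decide) e ρ).trans hA,
      (verify_run_of_le (by decide) e ρ).trans hT, (verify_run_of_le (by decide) e ρ).trans hX,
      (verify_run_of_le (by decide) e ρ).trans hL⟩
  refine (verify.compile_exec (d := 0) verify_wf hs (hv s) h).seq_of ?_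
  rintro s₁ ⟨g1, g2⟩
  refine (acceptFormula.compile_exec (d := 0) acceptFormula_wf (g1.base hs) (hv s₁) g2).seq_of ?_
  rintro s₂ ⟨k1, k2, k3⟩
  have hk₂ := g1.trans k2
  rw [hacc] at k3
  refine Exec.seq ((ite_const_skip_exec (Q := fun s₃ => s₃.mem = s₂.mem ∧
    (∀ r, r ≠ 0 → s₃.reg r = s₂.reg r) ∧ s₃.reg 0 = bit (P ∨ Accepts E A T X L)) ?_ ?_).imp ?_)
  · intro h4
    rw [k3, ne_eq, bit_eq_zero, not_not] at h4
    refine ⟨rfl, fun r hr => ?_, ?_⟩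
    · simp [Instr.apply, hr]
    · simp [Instr.apply, bit_of_true (Or.inr h4 : P ∨ Accepts E A T X L)]
  · intro h4
    rw [k3, bit_eq_zero] at h4
    refine ⟨rfl, fun r hr => rfl, ?_⟩
    simp [hk₂ 0 (by omega) (by omega), h0, h4]
  · rintro s₃ ⟨l1, l2, l3⟩
    have hb₃ : Base n s₃ := by
      have := hk₂.base hs
      exact ⟨(l2 1 (by decide)).trans this.1, (l2 2 (by decide)).trans this.2,
        (l2 3 (by decide)).trans this.3⟩
    have hm₃ : Holds (verify.run 0 e ρ) s₃.mem := by
      rw [l1, k1]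
      exact g2
    refine (coverFormula.compile_exec (d := 0) coverFormula_wf hb₃ (hv s₃) hm₃).seq_of ?_
    rintro s₄ ⟨q1, q2, q3⟩
    rw [hcov] at q3
    have hk₄ : ∀ r, r ≠ 0 → (r < 4 ∨ 10 ≤ r) → r < 20 → s₄.reg r = s.reg r := fun r h1 h2 h3 =>
      ((q2 r h2 h3).trans (l2 r h1)).trans (hk₂ r h2 h3)
    refine Exec.seq ((ite_const_skip_exec (Q := fun s₅ => s₅.mem = s₄.mem ∧
      (∀ r, r ≠ 15 → s₅.reg r = s₄.reg r) ∧ s₅.reg 15 = bit (Q ∧ ¬ Covers E A X)) ?_ ?_).imp ?_)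
    · intro h4
      rw [q3, ne_eq, bit_eq_zero, not_not] at h4
      refine ⟨rfl, fun r hr => ?_, ?_⟩
      · simp [Instr.apply, hr]
      · rw [bit_of_false fun h => h.2 h4]
        simp [Instr.apply]
    · intro h4
      rw [q3, bit_eq_zero] at h4
      refine ⟨rfl, fun r hr => rfl, ?_⟩
      simp [hk₄ 15 (by decide) (by omega) (by omega), h15, h4]
    · rintro s₅ ⟨p1, p2, p3⟩
      have hk₅ : ∀ r, r ≠ 0 → r ≠ 15 → (r < 4 ∨ 10 ≤ r) → r < 20 → s₅.reg r = s.reg r :=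
        fun r h1 h2 h3 h4 => (p2 r h2).trans (hk₄ r h1 h3 h4)
      have hup : ∀ r, r ≠ 12 → ((Instr.add 12 12 3).apply s₅).reg r = s₅.reg r := fun r hr => by
        simp [Instr.apply, hr]
      refine .instr ⟨⟨?_, ?_, ?_⟩, ?_, ?_, ?_, ?_, hst _ ?_⟩
      · rw [hup _ (by decide), hk₅ 1 (by omega) (by omega) (by omega) (by omega), hs.size]
      · rw [hup _ (by decide), hk₅ 2 (by omega) (by omega) (by omega) (by omega), hs.zero]
      · rw [hup _ (by decide), hk₅ 3 (by omega) (by omega) (by omega) (by omega), hs.one]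
      · intro r hr
        rw [hup r (by omega), hk₅ r (by omega) (by omega) (by omega) (by omega)]
      · simp [Instr.apply, hk₅ 12 (by omega) (by omega) (by omega) (by omega),
          hk₅ 3 (by omega) (by omega) (by omega) (by omega), hs.one]
      · rw [hup _ (by decide), p2 0 (by decide), q2 0 (by omega) (by omega), l3]
      · rw [hup _ (by decide), p3]
      · change Holds _ s₅.mem
        rw [p1, q1]
        exact hm₃

/-- Runs through all certificates for covers of size `k`; those are the numbers whose digits are
exhausted once the certificate is read. Then increases `k`, and keeps `m` equal to `4 k ^ 2`. -/
def levelProg : Program :=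
  rconst 12 0 ;; rconst 14 1 ;;
  Program.loop 14 (decodeProg ;; Program.ite 13 (rconst 14 0) testProg) ;;
  radd 19 10 10 ;; radd 19 19 19 ;; radd 19 19 19 ;; radd 11 11 19 ;; rconst 19 4 ;;
  radd 11 11 19 ;; radd 10 10 3

/-- Some certificate for covers of size `k` passes the test. -/
def SomeAccepts (E A T : Fin n → Fin n → Prop) (k : ℕ) : Prop :=
  ∃ c < n ^ (k + 2 * (4 * k ^ 2)),
    Accepts E A T (certCover n k c) (certArcs n k (4 * k ^ 2) c)

/-- Some certificate for covers of size `k` contains a cover. -/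
def SomeCovers (E A : Fin n → Fin n → Prop) (k : ℕ) : Prop :=
  ∃ c < n ^ (k + 2 * (4 * k ^ 2)), Covers E A (certCover n k c)

/-- A bound for the number of steps in the treatment of one certificate `c`. -/
def certCost (n k c : ℕ) : ℕ :=
  clearStmt.cost n + (1 + ((k * (5 * c + addrCost 5 n + 8) + 2) +
    (4 * k ^ 2 * (10 * c + addrCost 6 n + 13) + 2))) + (1 + testCost n + 1)

theorem certCost_mono {k c c' : ℕ} (h : c ≤ c') : certCost n k c ≤ certCost n k c' := by
  unfold certCost
  gcongr

/-- A bound for the number of steps of `levelProg`. -/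
def levelCost (n k : ℕ) : ℕ :=
  (n ^ (k + 2 * (4 * k ^ 2)) + 1) * (certCost n k (n ^ (k + 2 * (4 * k ^ 2))) + 1) + 10

theorem levelProg_exec {s : State} {P : Prop} {k : ℕ} (hs : Base n s) (hn : 0 < n)
    (h0 : s.reg 0 = bit P) (h15 : s.reg 15 = 1) (h10 : s.reg 10 = k) (h11 : s.reg 11 = 4 * k ^ 2)
    (hm : ∃ X L, Stored E A T X L s.mem) :
    Exec levelProg s (levelCost n k) fun s' => Base n s' ∧
      s'.reg 0 = bit (P ∨ SomeAccepts E A T k) ∧ s'.reg 15 = bit (¬ SomeCovers E A k) ∧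
      s'.reg 10 = k + 1 ∧ s'.reg 11 = 4 * (k + 1) ^ 2 ∧ ∃ X L, Stored E A T X L s'.mem := by
  set N := n ^ (k + 2 * (4 * k ^ 2)) with hN
  have hN0 : 0 < N := pow_pos hn _
  refine Exec.mono (T := 1 + (1 + (((N + 1) * (certCost n k N + 1) + 1) +
    (1 + (1 + (1 + (1 + (1 + (1 + 1))))))))) ?_ (by rw [levelCost, ← hN]; omega) fun _ h => h
  refine .seq (.instr (.seq (.instr (.seq ((Exec.loop (fun j s' => ∃ c, c ≤ N ∧
    ((j ≠ 0 ∧ c + j = N + 1 ∧ s'.reg 14 = 1 ∧ s'.reg 12 = c) ∨ (j = 0 ∧ c = N ∧ s'.reg 14 = 0)) ∧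
    Base n s' ∧ s'.reg 10 = k ∧ s'.reg 11 = 4 * k ^ 2 ∧
    s'.reg 0 = bit (P ∨ ∃ c' < c, Accepts E A T (certCover n k c') (certArcs n k (4 * k ^ 2) c')) ∧
    s'.reg 15 = bit (¬ ∃ c' < c, Covers E A (certCover n k c')) ∧
    ∃ X L, Stored E A T X L s'.mem) (N + 1) ?_ ?_ ?_).imp ?_)))))
  · refine ⟨0, by omega, Or.inl ⟨by omega, by omega, ?_, ?_⟩, ⟨?_, ?_, ?_⟩, ?_, ?_, ?_, ?_, hm⟩
    · simp [Instr.apply]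
    · simp [Instr.apply]
    · simp [Instr.apply, hs.size]
    · simp [Instr.apply, hs.zero]
    · simp [Instr.apply, hs.one]
    · simp [Instr.apply, h10]
    · simp [Instr.apply, h11]
    · simp [Instr.apply, h0]
    · simp [Instr.apply, h15, bit]
  · rintro s' ⟨c, -, h | h, -⟩
    exacts [absurd rfl h.1, h.2.2]
  · rintro j s' - ⟨c, hcN, hj, g1, g2, g3, g4, g5, X, L, g6⟩
    rcases hj with ⟨-, hj, hj14, hj12⟩ | ⟨hj, -⟩
    swap
    · exact absurd hj (Nat.succ_ne_zero j)
    refine ⟨by omega, Exec.mono (T := clearStmt.cost n +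
      (1 + ((k * (5 * c + addrCost 5 n + 8) + 2) +
        (4 * k ^ 2 * (10 * c + addrCost 6 n + 13) + 2))) + (1 + testCost n + 1)) ?_
      (certCost_mono (k := k) hcN) fun _ h => h⟩
    refine (decodeProg_exec g1 hn g2 g3 hj12 g6).seq_of ?_
    rintro s₁ ⟨k1, k2, k3⟩
    have hb₁ := k1.base g1
    rw [← hN] at k2
    refine .ite (fun h => .instr ?_) (fun h => ?_)
    · have hcN' : c = N := by
        by_contra hne
        rw [k2, Nat.div_eq_of_lt (by omega)] at h
        exact h rfl
      have hk : ∀ r, r ≠ 14 → ((Instr.const 14 0).apply s₁).reg r = s₁.reg r := fun r hr => by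
        simp [Instr.apply, hr]
      refine ⟨c, hcN, Or.inr ⟨by omega, hcN', ?_⟩, ⟨?_, ?_, ?_⟩, ?_, ?_, ?_, ?_, _, _, k3⟩
      · simp [Instr.apply]
      · rw [hk _ (by decide), hb₁.size]
      · rw [hk _ (by decide), hb₁.zero]
      · rw [hk _ (by decide), hb₁.one]
      · rw [hk _ (by decide), k1 10 (by omega), g2]
      · rw [hk _ (by decide), k1 11 (by omega), g3]
      · rw [hk _ (by decide), k1 0 (by omega), g4]
      · rw [hk _ (by decide), k1 15 (by omega), g5]
    · have hcN' : c < N := by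
        rw [k2, Nat.div_eq_zero_iff] at h
        omega
      have hex : ∀ p : ℕ → Prop, (∃ c' < c + 1, p c') ↔ (∃ c' < c, p c') ∨ p c := by
        intro p
        constructor
        · rintro ⟨c', h1, h2⟩
          rcases Nat.lt_succ_iff_lt_or_eq.1 h1 with h3 | rfl
          exacts [Or.inl ⟨c', h3, h2⟩, Or.inr h2]
        · rintro (⟨c', h1, h2⟩ | h2)
          exacts [⟨c', by omega, h2⟩, ⟨c, by omega, h2⟩]
      refine (testProg_exec hb₁ hn ((k1 0 (by omega)).trans g4) ((k1 15 (by omega)).trans g5)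
        k3).imp ?_
      rintro s₂ ⟨l1, l2, l3, l4, l5, l6⟩
      refine ⟨c + 1, hcN', Or.inl ⟨by omega, by omega, ?_, ?_⟩, l1, ?_, ?_, ?_, ?_, _, _, l6⟩
      · rw [l2 14 (by omega), k1 14 (by omega), hj14]
      · rw [l3, k1 12 (by omega), hj12]
      · rw [l2 10 (by omega), k1 10 (by omega), g2]
      · rw [l2 11 (by omega), k1 11 (by omega), g3]
      · rw [l4, hex, or_assoc]
      · rw [l5, hex, not_or]
  · rintro s' ⟨c, -, hj, g1, g2, g3, g4, g5, g6⟩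
    obtain rfl : c = N := by
      rcases hj with hj | hj
      exacts [absurd rfl hj.1, hj.2.1]
    refine .seq (.instr (.seq (.instr (.seq (.instr (.seq (.instr (.seq (.instr (.seq (.instr
      (.instr ⟨⟨?_, ?_, ?_⟩, ?_, ?_, ?_, ?_, g6⟩))))))))))))
    · simp [Instr.apply, g1.size]
    · simp [Instr.apply, g1.zero]
    · simp [Instr.apply, g1.one]
    · refine Eq.trans ?_ g4
      simp [Instr.apply]
    · refine Eq.trans ?_ g5
      simp [Instr.apply]
    · simp [Instr.apply, g1.one, g2]
    · simp [Instr.apply, g2, g3]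
      ring

/-- The enumeration ends at the latest with the covers of size `K` if there is one. It is correct
since passing the test is sound, and complete as soon as a cover is known. -/
theorem loop_levelProg_exec {s : State} {P : Prop} {k K B : ℕ} (hs : Base n s) (hn : 0 < n)
    (hkK : k ≤ K) (hB : ∀ k ≤ K, levelCost n k ≤ B) (hK : SomeCovers E A K)
    (hsound : ∀ k, SomeAccepts E A T k → Solvable E A T)
    (hcomplete : ∀ k, SomeCovers E A k → Solvable E A T → SomeAccepts E A T k)
    (hP : P → Solvable E A T)
    (h0 : s.reg 0 = bit P) (h15 : s.reg 15 = 1) (h10 : s.reg 10 = k) (h11 : s.reg 11 = 4 * k ^ 2)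
    (hm : ∃ X L, Stored E A T X L s.mem) :
    Exec (.loop 15 levelProg) s ((K - k + 1) * (B + 1) + 1) fun s' =>
      s'.reg 0 = bit (Solvable E A T) := by
  obtain ⟨j, rfl⟩ := Nat.exists_eq_add_of_le hkK
  induction j generalizing k s P with
  | zero =>
    simp only [add_zero] at hK hB ⊢
    refine Exec.mono (T := B + 1 + 1) (.loop_step (by omega) (((levelProg_exec hs hn h0 h15 h10 h11
      hm).mono (hB k (by omega)) fun _ h => h).imp ?_)) ?_ fun _ h => h
    · rintro s' ⟨-, g2, g3, -⟩
      refine .loop_done (by rw [g3, bit_of_false (not_not.2 hK)]) ?_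
      rw [g2]
      congr 1
      exact propext ⟨fun h => h.elim hP (hsound k), fun h => Or.inr (hcomplete k hK h)⟩
    · simp
  | succ j ih =>
    refine Exec.mono (T := B + ((k + (j + 1) - (k + 1) + 1) * (B + 1) + 1) + 1)
      (.loop_step (by omega) (((levelProg_exec hs hn h0 h15 h10 h11
      hm).mono (hB k (by omega)) fun _ h => h).imp ?_)) ?_ fun _ h => h
    · rintro s' ⟨g1, g2, g3, g4, g5, g6⟩
      by_cases hc : SomeCovers E A k
      · refine (Exec.loop_done (by rw [g3, bit_of_false (not_not.2 hc)]) ?_).mono (by omega)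
          fun _ h => h
        rw [g2]
        congr 1
        exact propext ⟨fun h => h.elim hP (hsound k), fun h => Or.inr (hcomplete k hc h)⟩
      · have hkj : k + (j + 1) = k + 1 + j := by omega
        rw [hkj] at hB hK ⊢
        exact ih g1 (fun h => h.elim hP (hsound k)) g2 (by rw [g3, bit_of_true hc])
          g4 g5 g6 (by omega) hB hK
    · have h1 : k + (j + 1) - (k + 1) = j := by omega
      have h2 : k + (j + 1) - k = j + 1 := by omega
      rw [h1, h2]
      ring_nf
      omega

theorem solvable_of_someAccepts {k : ℕ} (hsymm : ∀ a b, E a b → E b a) (hirr : ∀ a, ¬ E a a)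
    (h : SomeAccepts E A T k) : Solvable E A T := by
  obtain ⟨c, -, β, hβ⟩ := h
  exact solvable_of_linked hsymm hirr β hβ

theorem someAccepts_of_solvable {k : ℕ} (hn : 0 < n) (hsymm : ∀ a b, E a b → E b a)
    (hcyc : ∀ a b, ¬ OnMixedCycle E A a b) (hT : ∀ s, ¬ T s s) (hcov : SomeCovers E A k)
    (h : Solvable E A T) : SomeAccepts E A T k := by
  obtain ⟨c, -, hc⟩ := hcov
  obtain ⟨g, β, hβ⟩ := exists_linked (k := k)
    (fun j => (⟨c / n ^ (j : ℕ) % n, Nat.mod_lt _ hn⟩ : Fin n)) hsymm hcyc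
    (fun a b hab => by
      have key : ∀ u, certCover n k c u u →
          ∃ i : Fin k, (⟨c / n ^ (i : ℕ) % n, Nat.mod_lt _ hn⟩ : Fin n) = u := by
        rintro u ⟨-, j, hj, h⟩
        exact ⟨⟨j, hj⟩, Fin.ext h⟩
      exact (hc a b hab).imp (key a) (key b)) hT h
  obtain ⟨c', hc', h1, h2⟩ := exists_certificate hn
    (fun j : Fin k => (⟨c / n ^ (j : ℕ) % n, Nat.mod_lt _ hn⟩ : Fin n)) g
  refine ⟨c', hc', β, fun s t hst => ?_⟩
  rw [h1, h2]
  simpa using hβ s t hst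

/-! ### The running time -/

/-- The polynomially bounded parts of the running time. -/
def overhead (n : ℕ) : ℕ :=
  preprocess.cost n + clearStmt.cost n + testCost n + addrCost 5 n + addrCost 6 n + 40

theorem overhead_polyBounded : PolyBounded overhead := by
  have htest : PolyBounded testCost := (verify.cost_polyBounded).add
    ((acceptFormula.cost_polyBounded).add ((PolyBounded.const 3).add
      ((coverFormula.cost_polyBounded).add (.const (3 + 1)))))
  exact (((((preprocess.cost_polyBounded).add (clearStmt.cost_polyBounded)).add htest).add
    (addrCost_polyBounded 5)).add (addrCost_polyBounded 6)).add (.const 40)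

/-- The level `k` takes time polynomial in the number of certificates and in `n`. -/
theorem levelCost_le {n k K x y : ℕ} (hk : k ≤ K) (hx : n ^ (k + 2 * (4 * k ^ 2)) ≤ x)
    (hK : K + 4 * K ^ 2 ≤ x) (hx1 : 1 ≤ x) (hy : overhead n ≤ y) :
    levelCost n k ≤ 30 * (x ^ 3 * y) := by
  have hc := certCost_mono (n := n) (k := k) hx
  have h5 : addrCost 5 n + 8 ≤ y := by unfold overhead at hy; omega
  have h6 : addrCost 6 n + 13 ≤ y := by unfold overhead at hy; omega
  have hy1 : 1 ≤ y := by unfold overhead at hy; omega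
  have hcy : clearStmt.cost n + testCost n + 7 ≤ y := by unfold overhead at hy; omega
  have hk2 : 4 * k ^ 2 ≤ 4 * K ^ 2 := by gcongr
  have hkx : k + 4 * k ^ 2 ≤ x := by omega
  have hc1 : certCost n k x ≤ (k + 4 * k ^ 2) * (10 * x + y) + y := by
    have h1 : k * (5 * x + addrCost 5 n + 8) ≤ k * (10 * x + y) := Nat.mul_le_mul_left _ (by omega)
    have h2 : 4 * k ^ 2 * (10 * x + addrCost 6 n + 13) ≤ 4 * k ^ 2 * (10 * x + y) :=
      Nat.mul_le_mul_left _ (by omega)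
    have h3 : (k + 4 * k ^ 2) * (10 * x + y) = k * (10 * x + y) + 4 * k ^ 2 * (10 * x + y) := by
      ring
    rw [certCost, h3]
    omega
  have hxy : x ≤ x * y := Nat.le_mul_of_pos_right x hy1
  have hyx : y ≤ x * y := Nat.le_mul_of_pos_left y hx1
  have hc2 : certCost n k x + 1 ≤ 13 * (x * (x * y)) := by
    have h1 : (k + 4 * k ^ 2) * (10 * x + y) ≤ x * (11 * (x * y)) :=
      Nat.mul_le_mul hkx (by omega)
    have h2 : x * y ≤ x * (x * y) := Nat.le_mul_of_pos_left _ hx1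
    have h3 : x * (11 * (x * y)) = 11 * (x * (x * y)) := by ring
    omega
  have h1 : (n ^ (k + 2 * (4 * k ^ 2)) + 1) * (certCost n k (n ^ (k + 2 * (4 * k ^ 2))) + 1) ≤
      (2 * x) * (13 * (x * (x * y))) := Nat.mul_le_mul (by omega) (by omega)
  have h2 : (2 * x) * (13 * (x * (x * y))) = 26 * (x ^ 3 * y) := by ring
  have h3 : y ≤ x ^ 3 * y := Nat.le_mul_of_pos_left y (by positivity)
  have h4 : 40 ≤ y := by unfold overhead at hy; omega
  -- The additive constant is absorbed by `y`, and in total by the factor `30`.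
  rw [levelCost]
  omega

/-- The time bound of the whole algorithm; the last summand accounts for the instructions outside the
preprocessing and the enumeration. -/
theorem total_le {n K C : ℕ} (hC : overhead n ≤ max n 2 ^ C) :
    preprocess.cost n + (1 + ((K + 1) * (30 * ((max n 2 ^ (13 * max K 1 ^ 2)) ^ 3 * max n 2 ^ C) + 1)
      + 1)) + 4 ≤ max n 2 ^ ((C + 61) * max K 1 ^ 2) := by
  set B := max n 2 with hB
  set κ := max K 1 with hκ
  have hB2 : 2 ≤ B := le_max_right _ _
  have hκ1 : 1 ≤ κ := le_max_right _ _
  have hκ2 : 1 ≤ κ ^ 2 := Nat.one_le_pow _ _ hκ1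
  set x := B ^ (13 * κ ^ 2) with hx
  set y := B ^ C with hy
  have hx1 : 1 ≤ x := Nat.one_le_pow _ _ (by omega)
  have hy1 : 1 ≤ y := Nat.one_le_pow _ _ (by omega)
  have hKx : K + 1 ≤ x := by
    have h1 : K ≤ κ := le_max_left _ _
    have h2 : κ ≤ κ ^ 2 := Nat.le_self_pow (by decide) κ
    calc K + 1 ≤ 13 * κ ^ 2 := by omega
      _ ≤ 2 ^ (13 * κ ^ 2) := (Nat.lt_two_pow_self).le
      _ ≤ x := Nat.pow_le_pow_left hB2 _
  have hpre : preprocess.cost n + 10 ≤ y := by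
    unfold overhead at hC
    omega
  have h1 : (K + 1) * (30 * (x ^ 3 * y) + 1) ≤ x * (31 * (x ^ 3 * y)) := by
    have : 1 ≤ x ^ 3 * y := Nat.mul_pos (by positivity) hy1
    exact Nat.mul_le_mul hKx (by omega)
  have h2 : y ≤ x ^ 4 * y := Nat.le_mul_of_pos_left y (by positivity)
  have h3 : x * (31 * (x ^ 3 * y)) = 31 * (x ^ 4 * y) := by ring
  have h4 : 32 * (x ^ 4 * y) ≤ B ^ 5 * (x ^ 4 * y) :=
    Nat.mul_le_mul_right _ (Nat.pow_le_pow_left hB2 5)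
  have h5 : B ^ 5 * (x ^ 4 * y) = B ^ (5 + (52 * κ ^ 2 + C)) := by
    rw [hx, hy]
    ring
  have h6 : B ^ (5 + (52 * κ ^ 2 + C)) ≤ B ^ ((C + 61) * κ ^ 2) :=
    Nat.pow_le_pow_right (by omega) (by nlinarith)
  omega

/-! ### The input -/

theorem getD_flatMap {α β : Type*} {n : ℕ} (l : List α) (f : α → List β) (d : β)
    (hf : ∀ a, (f a).length = n) (i j : ℕ) (hi : i < l.length) (hj : j < n) :
    (l.flatMap f).getD (i * n + j) d = (f l[i]).getD j d := by
  induction l generalizing i with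
  | nil => simp at hi
  | cons a l ih =>
    rw [List.flatMap_cons]
    rcases i with _ | i
    · rw [List.getD_append _ _ _ _ (by rw [hf]; omega)]
      simp
    · have h1 : (i + 1) * n + j = n + (i * n + j) := by ring
      rw [List.getD_append_right _ _ _ _ (by rw [hf]; omega), hf, h1, Nat.add_sub_cancel_left,
        ih i (by simpa using hi)]
      simp

open SteinerInstance in
theorem length_matrixBits {n : ℕ} (R : Fin n → Fin n → Prop) :
    (matrixBits R).length = n * n := by
  simp [matrixBits, List.length_flatMap]

open SteinerInstance in
theorem getD_matrixBits {n : ℕ} (R : Fin n → Fin n → Prop) (u v : Fin n) :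
    (matrixBits R).getD (u * n + v) 0 = bit (R u v) := by
  rw [matrixBits, getD_flatMap _ _ _ (by simp) _ _ (by simp) v.2]
  have h : ∀ w : Fin n, (List.finRange n)[(w : ℕ)]'(by simp) = w := by simp
  rw [h u, List.getD_eq_getElem _ _ (by simp), List.getElem_map, h v, bit]

/-- The relations of the input; all further matrices are zero. -/
def inputRels {n : ℕ} (I : SteinerInstance n) : Rels n
  | 0 => fun u v => I.graph.edges.Adj u v
  | 1 => fun u v => (u, v) ∈ I.graph.arcs
  | 2 => fun u v => (u, v) ∈ I.terminals
  | _ => fun _ _ => False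

open SteinerInstance in
theorem holds_inputRels {n : ℕ} (I : SteinerInstance n) :
    Holds (inputRels I) (initial I.encode).mem := by
  intro a ha u v
  have hlt : (u : ℕ) * n + v < n * n := by
    calc (u : ℕ) * n + v < u * n + n := by omega
      _ = (u + 1) * n := by ring
      _ ≤ n * n := Nat.mul_le_mul_right n u.2
  have haddr : addr n a u v = a * (n * n) + (u * n + v) + 1 := by
    rw [addr]
    ring
  change I.encode.getD (addr n a u v) 0 ≠ 0 ↔ _
  rw [haddr, encode, List.getD_cons_succ]
  have hlen := fun R : Fin n → Fin n → Prop => length_matrixBits R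
  rcases a with _ | _ | _ | a
  · rw [List.getD_append _ _ _ _ (by rw [List.length_append, hlen, hlen]; omega),
      List.getD_append _ _ _ _ (by rw [hlen]; omega), zero_mul, zero_add, getD_matrixBits]
    simp [inputRels]
  · rw [List.getD_append _ _ _ _ (by rw [List.length_append, hlen, hlen]; omega),
      List.getD_append_right _ _ _ _ (by rw [hlen]; omega), hlen, zero_add, one_mul,
      Nat.add_sub_cancel_left, getD_matrixBits]
    simp [inputRels]
  · rw [List.getD_append_right _ _ _ _ (by rw [List.length_append, hlen, hlen]; omega),
      List.length_append, hlen, hlen]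
    have : (0 + 1 + 1) * (n * n) + (u * n + v) - (n * n + n * n) = u * n + v := by omega
    rw [this, getD_matrixBits]
    simp [inputRels]
  · rw [List.getD_eq_default]
    · rcases a with _ | a
      · exact absurd rfl ha
      · simp [inputRels]
    · rw [List.length_append, List.length_append, hlen, hlen, hlen]
      have : (a + 1 + 1 + 1) * (n * n) = a * (n * n) + 3 * (n * n) := by ring
      omega

theorem isYes_iff_solvable {n : ℕ} (I : SteinerInstance n) :
    I.IsYes ↔ Solvable (inputRels I 0) (inputRels I 1) (inputRels I 2) := by
  constructor
  · rintro ⟨D, hD, hT⟩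
    exact ⟨fun u v => (u, v) ∈ D, hD, fun s t hst => hT (s, t) hst⟩
  · rintro ⟨D, hD, hT⟩
    exact ⟨{p | D p.1 p.2}, hD, fun p hp => hT p.1 p.2 hp⟩

theorem exists_cover {n : ℕ} (I : SteinerInstance n) :
    ∃ x : Fin I.vc → Fin n, ∀ u v, I.graph.underlying.Adj u v → (∃ i, x i = u) ∨ ∃ i, x i = v := by
  obtain ⟨S, hS, hcov⟩ := I.graph.underlying.vertexCoverNum_exists
  have hcard : Nat.card S = I.vc := by
    rw [SteinerInstance.vc, ← hS, Nat.card_coe_set_eq, Set.ncard]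
  let e : S ≃ Fin I.vc := Finite.equivFinOfCardEq hcard
  have key : ∀ u ∈ S, ∃ i, ((e.symm i : S) : Fin n) = u := fun u hu => ⟨e ⟨u, hu⟩, by simp⟩
  exact ⟨fun i => e.symm i, fun u v h => (hcov h).imp (key u) (key v)⟩

/-- The algorithm. The empty graph is a yes-instance. -/
def steinerProgram : Program :=
  rload 1 2 ;; rconst 3 1 ;;
  Program.ite 1 (preprocess.compile 0 ;; rconst 15 1 ;; Program.loop 15 levelProg) (rconst 0 1)

theorem steinerProgram_exec : ∃ C, ∀ (n : ℕ) (I : SteinerInstance n),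
    Exec steinerProgram (initial I.encode) (max n 2 ^ (C * max I.vc 1 ^ 2)) fun s =>
      s.reg 0 = bit I.IsYes := by
  obtain ⟨C, hC⟩ := overhead_polyBounded
  refine ⟨C + 61, fun n I => ?_⟩
  set K := I.vc with hK
  set B := 30 * ((max n 2 ^ (13 * max K 1 ^ 2)) ^ 3 * max n 2 ^ C) with hB
  refine Exec.mono (T := 1 + (1 + ((preprocess.cost n + (1 + ((K + 1) * (B + 1) + 1))) + 1 + 1)))
    ?_ ?_ fun _ h => h
  swap
  · have := total_le (K := K) (hC n)
    rw [← hB] at this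
    omega
  refine .seq (.instr (.seq (.instr ?_)))
  set s := (Instr.const 3 1).apply ((Instr.load 1 2).apply (initial I.encode)) with hs
  have hbase : Base n s := by
    refine ⟨?_, ?_, ?_⟩ <;> simp [hs, Instr.apply, initial, SteinerInstance.encode]
  have hreg : ∀ r, 4 ≤ r ∨ r = 0 → s.reg r = 0 := fun r hr => by
    simp (disch := omega) [hs, Instr.apply, initial, Function.update_of_ne]
  have hholds : Holds (inputRels I) s.mem := holds_inputRels I
  refine .ite (fun h1 => ?_) (fun h1 => .instr ?_)
  · have hn : 0 < n := by
      rw [hbase.size] at h1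
      omega
    let e : ℕ → Fin n := fun _ => ⟨0, hn⟩
    refine (preprocess.compile_exec (d := 0) (e := e) preprocess_wf hbase
      (fun i hi => absurd hi (Nat.not_lt_zero i)) hholds).seq_of ?_
    rintro s₁ ⟨g1, g2⟩
    obtain ⟨hred, hcyc⟩ := preprocess_run e (inputRels I) (fun a b => I.graph.edges.symm.symm a b)
      fun a => I.graph.edges.irrefl
    have hT2 : preprocess.run 0 e (inputRels I) 2 = inputRels I 2 :=
      Stmt.run_of_not_writes _ (by simp [preprocess, orientStmt, warshall, Stmt.Writes])
    set E := preprocess.run 0 e (inputRels I) 0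
    set A := preprocess.run 0 e (inputRels I) 1
    have hirrT : ∀ t, ¬ inputRels I 2 t t := fun t ht => I.terminals_ne (t, t) ht rfl
    have hcover : SomeCovers E A K := by
      obtain ⟨x, hx⟩ := exists_cover I
      obtain ⟨c, hc, h2, -⟩ := exists_certificate (m := 4 * K ^ 2) hn x fun _ => (⟨0, hn⟩, ⟨0, hn⟩)
      refine ⟨c, hc, fun u v huv => ?_⟩
      rw [h2]
      have : I.graph.underlying.Adj u v :=
        (hred.adj_iff u v).1 (huv.imp_right fun h => Or.inl h)
      simpa using hx u v this
    have hlevel : ∀ k ≤ K, levelCost n k ≤ B := by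
      intro k hk
      have h1 : k ≤ max K 1 := hk.trans (le_max_left _ _)
      have h2 : K ≤ max K 1 := le_max_left _ _
      have h3 : ∀ a, a ≤ max K 1 → a + 2 * (4 * a ^ 2) ≤ 13 * max K 1 ^ 2 := fun a ha => by
        have h4 : a ^ 2 ≤ max K 1 ^ 2 := Nat.pow_le_pow_left ha 2
        have h5 : max K 1 ≤ max K 1 ^ 2 := Nat.le_self_pow (by decide) _
        omega
      refine levelCost_le hk ?_ ?_ (Nat.one_le_pow _ _ (by omega)) (hC n)
      · exact (Nat.pow_le_pow_left (le_max_left n 2) _).trans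
          (Nat.pow_le_pow_right (by omega) (h3 k h1))
      · calc K + 4 * K ^ 2 ≤ 13 * max K 1 ^ 2 := by have := h3 K h2; omega
          _ ≤ 2 ^ (13 * max K 1 ^ 2) := (Nat.lt_two_pow_self).le
          _ ≤ _ := Nat.pow_le_pow_left (le_max_right n 2) _
    refine .seq (.instr ?_)
    have hk₁ : ∀ r, r = 0 ∨ r = 10 ∨ r = 11 → ((Instr.const 15 1).apply s₁).reg r = 0 :=
      fun r hr => by
        simp (disch := omega) only [Instr.apply, Function.update_of_ne]
        rw [g1 r (by omega) (by omega), hreg r (by omega)]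
    have hb₁ := g1.base hbase
    refine (loop_levelProg_exec (P := False) (k := 0) (K := K) (T := inputRels I 2) (E := E) (A := A)
      ?_ hn (Nat.zero_le _) hlevel hcover
      (fun k => solvable_of_someAccepts hred.symm hred.irrefl)
      (fun k => someAccepts_of_solvable hn hred.symm hcyc hirrT) False.elim ?_ ?_ ?_ ?_ ?_).imp ?_
    · refine ⟨?_, ?_, ?_⟩
      · simp [Instr.apply, hb₁.size]
      · simp [Instr.apply, hb₁.zero]
      · simp [Instr.apply, hb₁.one]
    · rw [hk₁ 0 (by omega)]
      simp [bit]
    · simp [Instr.apply]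
    · rw [hk₁ 10 (by omega)]
    · rw [hk₁ 11 (by omega)]
      rfl
    · exact ⟨_, _, _, g2, rfl, rfl, hT2, rfl, rfl⟩
    · intro s' h
      rw [h, isYes_iff_solvable]
      congr 1
      exact propext hred.solvable_iff
  · have hn : n = 0 := hbase.size.symm.trans h1
    subst hn
    rw [bit_of_true]
    · simp [Instr.apply]
    · exact ⟨∅, ⟨fun u => u.elim0, fun u => u.elim0⟩, fun p => p.1.elim0⟩

end SteinerOrientation

/-- One deterministic algorithm decides Steiner Orientation (it halts with `1` in register `0` on
yes-instances, and with `0` on no-instances) in time `n ^ O(vc ^ 2)`. The two maxima only matter on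
instances without edges and arcs. -/
theorem theorem4 :
    ∃ (P : RAM.Program) (C : ℕ), ∀ (n : ℕ) (I : SteinerInstance n),
      ∃ (s : RAM.State) (t : ℕ),
        RAM.Runs P (RAM.initial I.encode) s t ∧
        t ≤ (max n 2) ^ (C * (max I.vc 1) ^ 2) ∧
        (I.IsYes → s.reg 0 = 1) ∧
        (¬ I.IsYes → s.reg 0 = 0) := by
  obtain ⟨C, hC⟩ := SteinerOrientation.steinerProgram_exec
  refine ⟨SteinerOrientation.steinerProgram, C, fun n I => ?_⟩
  obtain ⟨s, t, h1, h2, h3⟩ := hC n I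
  exact ⟨s, t, h1, h2, fun h => h3.trans (SteinerOrientation.bit_of_true h),
    fun h => h3.trans (SteinerOrientation.bit_of_false h)⟩
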